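/- **Setting.** A weighted graph $G=(V,E,c)$ is a connected simple graph on $V=[n]$ with edge costs $c:E\to\mathbb R_{\ge 0}$ (graphs produced by the algorithm need not be connected). For $S\subseteq V$ let $\delta_G(S)=\sum_{uv\in E,\,u\in S,\,v\notin S}c_{uv}$. *Compilations.* Start from couplings $C_{uv}=0$ ($u\ne v$) and from the empty set $F$ of flipped vertices. A bit flip of $v$ changes the membership of $v$ in $F$; an $H_{\mathrm{Ising}}$ pulse of length $t>0$ and sign $\pm$ replaces every $C_{uv}$ by $C_{uv}\pm(-1)^{\mathbf 1_F(u)+\mathbf 1_F(v)}t$. A compilation of $G$ is a finite sequence of pulses and bit flips that ends with $F=\emptyset$ and $C_{uv}=c_{uv}$ for all $u\neq v$ (with $c_{uv}=0$ if $uv\notin E$). $N(H_{\mathrm{Ising}})(G)$ and $N(\mathrm{Total}_{\mathrm{Ops}})(G)$ are the minimum number of pulses and the minimum number of operations (pulses and bit flips) in a compilation of $G$. *Sparsification* $(G,\epsilon)$. Put $q=\lceil C_0 n\log n/\epsilon^2\rceil$ for a constant $C_0$. Choose $q$ edges of $G$ independently, each edge $e$ with probability $p_e$ proportional to $c_er_e$,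 where $r_e$ is the effective resistance between the endpoints of $e$ in the network with conductances $c$. Each time an edge $e$ is chosen, $c_e/(qp_e)$ is added to its weight in the output graph. (If all costs are $0$, the output has no edges.) *exp-decompose* $(H,\epsilon)$, where $H$ has costs $\bar c$ with maximum $c^*$. Put $\tau=\frac{\epsilon c^*}{2n^2}$ and $k=\lceil\log_{1+\epsilon/2}(c^*/\tau)\rceil$; for $j\in[k]$ let $H_j$ be the unweighted graph of the edges $e$ of $H$ with $\tau(1+\epsilon/2)^{j-1}<\bar c(e)\le\tau(1+\epsilon/2)^j$. Return $\sum_{j\in[k]}\tau(1+\epsilon/2)^{j-1}H_j$. *binary-decompose* $(H,\epsilon)$. Put $\eta=\frac{\epsilon c^*}{n^2}$ and $k=1+\lfloor\log_2(n^2/\epsilon)\rfloor$; for $j\in[k]$ let $H_j$ be the unweighted graph of the edges $e$ of $H$ for which the binary digit of $\lfloor\bar c(e)/\eta\rfloor$ at $2^{j-1}$ is $1$. Return $\sum_{j\in[k]}\eta2^{j-1}H_j$. *sparse-union-of-stars* $(G,\epsilon_1,\epsilon_2)$. Let $H$ be the output of sparsification on $(G,\epsilon_1)$; compute $G'_{\mathrm{bin}}$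 and $G'_{\mathrm{exp}}$ by binary-decompose and exp-decompose on $(H,\epsilon_2)$; return $G'=G'_{\mathrm{bin}}$ if $N(H_{\mathrm{Ising}})(G'_{\mathrm{bin}})<N(H_{\mathrm{Ising}})(G'_{\mathrm{exp}})$, and $G'=G'_{\mathrm{exp}}$ otherwise. **Theorem.** For every sufficiently large constant $C_0$ there are a constant $C$ and numbers $p_n\to1$, depending only on $C_0$, such that for every weighted graph $G=(V,E,c)$ on $n$ vertices and every $\epsilon\in(0,1)$, sparse-union-of-stars with $\epsilon_1=\epsilon_2=\epsilon/3$ returns a random graph $G'$ such that, with probability at least $p_n$, the costs of $G'$ are nonnegative and all of the following hold: 1. for all $S\subseteq V$ with $\delta_G(S)\ge\frac12\sum_{e\in E}c_e$, we have $(1-\epsilon)\,\delta_G(S)\le\delta_{G'}(S)\le(1+\epsilon)\,\delta_G(S)$; moreover every maximum cut $S$ of $G'$ satisfies $\delta_G(S)\ge(1-\epsilon)\max_{T\subseteq V}\delta_G(T)$; 2. $N(H_{\mathrm{Ising}})(G')\le C\,n\log\frac n\epsilon$; 3. $N(\mathrm{Total}_{\mathrm{Ops}})(G')\le C\,\dfrac{n\log(n/\epsilon)}{\epsilon^2}$.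 -/

import Mathlib

noncomputable section

/-- A weighted simple graph `(V, E, c)` on the vertex set `Fin n`; the edge cost function is
extended by `0` to the pairs that are not edges. -/
structure WGraph (n : ℕ) where
  graph : SimpleGraph (Fin n)
  cost : Sym2 (Fin n) → ℝ
  cost_of_notMem : ∀ e, e ∉ graph.edgeSet → cost e = 0

namespace WGraph

variable {n : ℕ}

def Nonneg (G : WGraph n) : Prop := ∀ e, 0 ≤ G.cost e

/-- The value of the cut `S`. -/
def cut (G : WGraph n) (S : Finset (Fin n)) : ℝ := ∑ u ∈ S, ∑ v ∈ Sᶜ, G.cost s(u, v)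

def totalCost (G : WGraph n) : ℝ := ∑ e : Sym2 (Fin n), G.cost e

/-- The largest edge cost (`0` if there is no edge). -/
def maxCost (G : WGraph n) : ℝ := sSup (G.cost '' G.graph.edgeSet)

def IsMaxCut (G : WGraph n) (S : Finset (Fin n)) : Prop := ∀ T, G.cut T ≤ G.cut S

open Classical in
/-- `∑_{j = 1}^{k} α j • F j` for unweighted graphs `F 1, …, F k`. -/
def weightedSum (k : ℕ) (α : ℕ → ℝ) (F : ℕ → SimpleGraph (Fin n)) : WGraph n where
  graph := SimpleGraph.fromEdgeSet (⋃ j ∈ Finset.Icc 1 k, (F j).edgeSet)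
  cost e := ∑ j ∈ Finset.Icc 1 k, if e ∈ (F j).edgeSet then α j else 0
  cost_of_notMem e he := by
    refine Finset.sum_eq_zero fun j hj => if_neg fun h => he ?_
    rw [SimpleGraph.edgeSet_fromEdgeSet]
    exact ⟨Set.mem_biUnion (Finset.mem_coe.2 hj) h, (F j).not_isDiag_of_mem_edgeSet h⟩

/-- The graph without edges. -/
def edgeless (n : ℕ) : WGraph n where
  graph := ⊥
  cost _ := 0
  cost_of_notMem _ _ := rfl

end WGraph

/-! ### Compilation by Ising pulses and bit flips -/

/-- An operation on `n` ions: a global Ising pulse of length `t > 0` and either sign, or a bit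
flip (Pauli `X`) of a single ion. -/
inductive IonOp (n : ℕ) where
  | pulse (positive : Bool) (t : ℝ) (ht : 0 < t) : IonOp n
  | flip (v : Fin n) : IonOp n

/-- The ions that are currently flipped, and the coefficients `C u v` of the products
`σᶻ_u σᶻ_v`, `u ≠ v`, that have been accumulated in the Hamiltonian. -/
@[ext]
structure IonState (n : ℕ) where
  flipped : Finset (Fin n)
  coupling : Fin n → Fin n → ℝ

namespace IonOp

variable {n : ℕ}

def step (s : IonState n) : IonOp n → IonState n
  | pulse positive t _ =>
    { flipped := s.flipped
      coupling := fun u v => s.coupling u v +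
        (if positive then 1 else -1) *
          ((-1) ^ ((if u ∈ s.flipped then 1 else 0) + (if v ∈ s.flipped then 1 else 0)) * t) }
  | flip v =>
    { flipped := if v ∈ s.flipped then s.flipped.erase v else insert v s.flipped
      coupling := s.coupling }

/-- The state after a sequence of operations, starting from the zero Hamiltonian. -/
def run (ops : List (IonOp n)) : IonState n :=
  ops.foldl step { flipped := ∅, coupling := fun _ _ => 0 }

def isPulse : IonOp n → Bool
  | pulse _ _ _ => true
  | flip _ => false

/-- `ops` is a graph compilation of `G`: it produces the couplings of `G`, and all bit flips have
been undone at the end (so that compilations can be concatenated). -/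
def Compiles (ops : List (IonOp n)) (G : WGraph n) : Prop :=
  (run ops).flipped = ∅ ∧ ∀ u v, u ≠ v → (run ops).coupling u v = G.cost s(u, v)

/-- `ops` adds `M` to the couplings. -/
def Adds (ops : List (IonOp n)) (M : Fin n → Fin n → ℝ) : Prop :=
  ∀ A : Fin n → Fin n → ℝ,
    ops.foldl step { flipped := ∅, coupling := A } = { flipped := ∅, coupling := A + M }

theorem exists_adds_pair (u v : Fin n) (h : u ≠ v) (c : ℝ) :
    ∃ ops, Adds ops (fun a b => if s(a, b) = s(u, v) then c else 0) := by
  rcases eq_or_ne c 0 with rfl | hc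
  · exact ⟨[], fun A => by ext <;> simp⟩
  have ht : 0 < |c| / 4 := by positivity
  have hs : (if decide (0 < c) = true then (1 : ℝ) else -1) * (|c| / 4) = c / 4 := by
    rcases lt_or_gt_of_ne hc with h0 | h0
    · simp only [not_lt.2 h0.le, decide_false, abs_of_neg h0]; norm_num; ring
    · simp [h0, abs_of_pos h0]
  have hs' : (if (!decide (0 < c)) = true then (1 : ℝ) else -1) * (|c| / 4) = -(c / 4) := by
    rcases lt_or_gt_of_ne hc with h0 | h0
    · simp only [not_lt.2 h0.le, decide_false, abs_of_neg h0]; norm_num; ring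
    · simp [h0, abs_of_pos h0]
  refine ⟨[pulse (decide (0 < c)) _ ht, flip u, pulse (!decide (0 < c)) _ ht, flip v,
    pulse (decide (0 < c)) _ ht, flip u, pulse (!decide (0 < c)) _ ht, flip v], fun A => ?_⟩
  have e1 : (insert v ({u} : Finset (Fin n))).erase u = {v} := by
    ext a; simp only [Finset.mem_erase, Finset.mem_insert, Finset.mem_singleton]; grind
  simp only [List.foldl, step, Finset.notMem_empty, if_false, insert_empty_eq,
    Finset.mem_singleton, h.symm, Finset.mem_insert, or_true, if_true, e1,
    Finset.erase_singleton, mul_left_comm _ ((-1 : ℝ) ^ (_ : ℕ)), hs, hs']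
  congr 1
  funext a b
  simp only [Pi.add_apply, Sym2.eq_iff]
  by_cases a1 : a = u <;> by_cases a2 : a = v <;> by_cases b1 : b = u <;> by_cases b2 : b = v <;>
    simp_all <;> ring

/-- Every weighted graph has a graph compilation. -/
theorem exists_compiles (G : WGraph n) : ∃ ops, Compiles ops G := by
  have key : ∀ s : Finset (Sym2 (Fin n)), (∀ e ∈ s, ¬ e.IsDiag) →
      ∃ ops, Adds ops (fun a b => if s(a, b) ∈ s then G.cost s(a, b) else 0) := by
    intro s
    induction s using Finset.induction_on with
    | empty => exact fun _ => ⟨[], fun A => by ext <;> simp⟩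
    | insert e s he ih =>
      intro hs
      obtain ⟨l, hl⟩ := ih fun f hf => hs f (Finset.mem_insert_of_mem hf)
      induction e using Sym2.ind with
      | _ u v =>
        obtain ⟨l', hl'⟩ := exists_adds_pair u v
          (by simpa using hs s(u, v) (Finset.mem_insert_self _ _)) (G.cost s(u, v))
        refine ⟨l ++ l', fun A => ?_⟩
        rw [List.foldl_append, hl, hl']
        congr 1
        funext a b
        simp only [Pi.add_apply, Finset.mem_insert]
        by_cases h1 : s(a, b) = s(u, v)
        · simp only [h1, he, if_true, if_false, true_or]; ring
        · simp [h1]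
  obtain ⟨ops, h⟩ := key (Finset.univ.filter fun e => ¬ e.IsDiag) (by simp)
  refine ⟨ops, ?_, fun u v huv => ?_⟩
  · rw [run, h]
  · rw [run, h]
    simp [huv]

end IonOp

namespace WGraph

variable {n : ℕ}

/-- `N(H_Ising)(G)`: the least number of pulses in a graph compilation of `G`. -/
def pulseNumber (G : WGraph n) : ℕ :=
  sInf ((fun ops => ops.countP IonOp.isPulse) '' {ops : List (IonOp n) | IonOp.Compiles ops G})

/-- `N(Total_Ops)(G)`: the least number of operations (pulses and bit flips) in a graph
compilation of `G`. -/
def totalOpsNumber (G : WGraph n) : ℕ :=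
  sInf (List.length '' {ops : List (IonOp n) | IonOp.Compiles ops G})

/-! ### The two decompositions -/

/-- The decomposition that groups the edges by the scale of their costs. -/
def expDecompose (G : WGraph n) (ε : ℝ) : WGraph n :=
  let τ := ε * G.maxCost / (2 * (n : ℝ) ^ 2)
  let k := ⌈Real.logb (1 + ε / 2) (G.maxCost / τ)⌉₊
  weightedSum k (fun j => τ * (1 + ε / 2) ^ (j - 1)) fun j =>
    SimpleGraph.fromEdgeSet {e ∈ G.graph.edgeSet |
      τ * (1 + ε / 2) ^ (j - 1) < G.cost e ∧ G.cost e ≤ τ * (1 + ε / 2) ^ j}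

/-- The decomposition by the binary digits of the rounded edge costs. -/
def binaryDecompose (G : WGraph n) (ε : ℝ) : WGraph n :=
  let η := ε * G.maxCost / (n : ℝ) ^ 2
  let k := 1 + ⌊Real.logb 2 ((n : ℝ) ^ 2 / ε)⌋₊
  weightedSum k (fun j => η * 2 ^ (j - 1)) fun j =>
    SimpleGraph.fromEdgeSet {e ∈ G.graph.edgeSet | ⌊G.cost e / η⌋₊.testBit (j - 1) = true}

/-- Whichever of the two decompositions needs fewer pulses. -/
def bestDecompose (G : WGraph n) (ε : ℝ) : WGraph n :=
  if (G.binaryDecompose ε).pulseNumber < (G.expDecompose ε).pulseNumber then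
    G.binaryDecompose ε
  else
    G.expDecompose ε

/-! ### Sparsification by effective resistances -/

/-- In the electrical network in which every edge `e` has conductance `cost e`, the vertex
potentials `φ` drive a unit current from `u` to `v` (Kirchhoff's law at every vertex `w`). -/
def IsUnitFlow (G : WGraph n) (u v : Fin n) (φ : Fin n → ℝ) : Prop :=
  ∀ w, ∑ x, G.cost s(w, x) * (φ w - φ x) = (if w = u then 1 else 0) - (if w = v then 1 else 0)

/-- `r` is the potential difference between the endpoints of `e` under a unit current from one to
the other. -/
def IsEffectiveResistance (G : WGraph n) (e : Sym2 (Fin n)) (r : ℝ) : Prop :=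
  ∃ u v φ, e = s(u, v) ∧ G.IsUnitFlow u v φ ∧ r = φ u - φ v

theorem IsUnitFlow.unique {G : WGraph n} {u v : Fin n} {φ ψ : Fin n → ℝ}
    (hφ : G.IsUnitFlow u v φ) (hψ : G.IsUnitFlow u v ψ) : φ u - φ v = ψ u - ψ v := by
  have h1 : ∀ α β : Fin n → ℝ, G.IsUnitFlow u v α →
      ∑ w, β w * ∑ x, G.cost s(w, x) * (α w - α x) = β u - β v := fun α β h => by
    rw [Finset.sum_congr rfl fun w _ => congrArg (β w * ·) (h w)]
    simp only [mul_sub, Finset.sum_sub_distrib, mul_ite, mul_one, mul_zero,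
      Finset.sum_ite_eq', Finset.mem_univ, if_true]
  have hsw : ∀ α β : Fin n → ℝ, ∑ w, ∑ x, G.cost s(w, x) * (β w * α x) =
      ∑ w, ∑ x, G.cost s(w, x) * (α w * β x) := fun α β => by
    rw [Finset.sum_comm]
    refine Finset.sum_congr rfl fun w _ => Finset.sum_congr rfl fun x _ => ?_
    rw [Sym2.eq_swap, mul_comm (β x)]
  have hx : ∀ α β : Fin n → ℝ, ∑ w, β w * ∑ x, G.cost s(w, x) * (α w - α x) =
      ∑ w, ∑ x, G.cost s(w, x) * (α w * β w) - ∑ w, ∑ x, G.cost s(w, x) * (β w * α x) :=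
    fun α β => by
      simp only [Finset.mul_sum, ← Finset.sum_sub_distrib]
      refine Finset.sum_congr rfl fun w _ => Finset.sum_congr rfl fun x _ => ?_
      ring
  rw [← h1 ψ φ hψ, ← h1 φ ψ hφ, hx, hx, hsw ψ φ]
  simp only [mul_comm (ψ _) (φ _)]

theorem IsUnitFlow.neg {G : WGraph n} {u v : Fin n} {φ : Fin n → ℝ}
    (hφ : G.IsUnitFlow u v φ) : G.IsUnitFlow v u (-φ) := fun w => by
  have h : ∑ x, G.cost s(w, x) * ((-φ) w - (-φ) x) = -∑ x, G.cost s(w, x) * (φ w - φ x) := by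
    rw [← Finset.sum_neg_distrib]
    exact Finset.sum_congr rfl fun x _ => by simp only [Pi.neg_apply]; ring
  rw [h, hφ w]
  ring

theorem IsEffectiveResistance.unique {G : WGraph n} {e : Sym2 (Fin n)} {r r' : ℝ}
    (h : G.IsEffectiveResistance e r) (h' : G.IsEffectiveResistance e r') : r = r' := by
  obtain ⟨u, v, φ, rfl, hφ, rfl⟩ := h
  obtain ⟨u', v', ψ, huv, hψ, rfl⟩ := h'
  rcases Sym2.eq_iff.1 huv with ⟨rfl, rfl⟩ | ⟨rfl, rfl⟩
  · exact hφ.unique hψ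
  · rw [hφ.unique hψ.neg]
    simp only [Pi.neg_apply]
    ring

open Classical in
/-- The effective resistance of `e`. If the costs are nonnegative, a value exists for every edge of
positive cost; the value `0` is used for pairs that are not joined by edges of positive cost. -/
def effectiveResistance (G : WGraph n) (e : Sym2 (Fin n)) : ℝ :=
  if h : ∃ r, G.IsEffectiveResistance e r then h.choose else 0

/-- The number to which the sampling probability of `e` is proportional. -/
def leverage (G : WGraph n) (e : Sym2 (Fin n)) : ENNReal :=
  ENNReal.ofReal (G.cost e * G.effectiveResistance e)

/-- The distribution of a random edge chosen with probability proportional to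
`cost e * effectiveResistance e`. -/
def edgeDist (G : WGraph n) (h : ∑' e, G.leverage e ≠ 0) : PMF (Sym2 (Fin n)) :=
  PMF.normalize G.leverage h (by
    rw [tsum_fintype]
    exact ENNReal.sum_ne_top.2 fun _ _ => ENNReal.ofReal_ne_top)

/-- The distribution of `q` independent samples from `p`. -/
def iidDist {α : Type*} [Fintype α] (p : PMF α) (q : ℕ) : PMF (Fin q → α) :=
  PMF.ofFintype (fun ω => ∏ t, p (ω t)) (by
    classical
    have h : ∑ a, p a = 1 := (tsum_fintype _).symm.trans p.tsum_coe
    rw [← Fintype.prod_sum]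
    simp [h])

open Classical in
/-- The graph built from the samples `ω`: each sample of an edge `e` adds `cost e / (q * p e)` to
the weight of `e`. -/
def sampledGraph (G : WGraph n) (p : PMF (Sym2 (Fin n))) {q : ℕ} (ω : Fin q → Sym2 (Fin n)) :
    WGraph n where
  graph := SimpleGraph.fromEdgeSet (G.graph.edgeSet ∩ Set.range ω)
  cost e := ∑ t, if ω t = e then G.cost e / (q * (p e).toReal) else 0
  cost_of_notMem e he := by
    refine Finset.sum_eq_zero fun t _ => ?_
    split_ifs with h
    · rw [G.cost_of_notMem e fun h' => he ?_, zero_div]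
      rw [SimpleGraph.edgeSet_fromEdgeSet]
      exact ⟨⟨h', t, h⟩, G.graph.not_isDiag_of_mem_edgeSet h'⟩
    · rfl

open Classical in
/-- Sparsification of `G` by `q = ⌈C₀ n log n / ε²⌉` independent samples; if all costs are zero,
so that there is nothing to sample, the result is the graph without edges. -/
def sparsify (C₀ : ℝ) (G : WGraph n) (ε : ℝ) : PMF (WGraph n) :=
  if h : ∑' e, G.leverage e ≠ 0 then
    (iidDist (G.edgeDist h) ⌈C₀ * n * Real.log n / ε ^ 2⌉₊).map (G.sampledGraph (G.edgeDist h))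
  else
    PMF.pure (edgeless n)

/-- The distribution of the graph returned by the algorithm: sparsify with error `ε₁`, then apply
the better of the two decompositions with error `ε₂`. -/
def sparseUnionOfStars (C₀ : ℝ) (G : WGraph n) (ε₁ ε₂ : ℝ) : PMF (WGraph n) :=
  (G.sparsify C₀ ε₁).map fun H => H.bestDecompose ε₂

end WGraph

end

/-!
Foster's theorem, `∑ c_e r_e ≤ n`, and the Cauchy–Schwarz bound `1 ≤ wdeg u * r_uv` give
`c_uv ≤ n * wdeg u * p_uv` for the sampling probabilities: a single sample is small compared with
the weighted degree of either endpoint. Round the weighted degrees to dyadic levels. At most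
`2 ^ (i + 2)` vertices have level `i` or below, so only `2 ^ (2 ^ (i + 2))` restrictions of cuts
matter at level `i`, and a Chernoff bound is strong enough for a union bound over them. Hence, with
high probability, all cuts of the sparsifier `H` are off by at most `ε / 16` times the total cost.
A maximum cut has at least half the total cost, which turns this additive error into a relative one.

Rounding costs down changes a cut of `H` by at most the fraction `ε / 3` of a maximum cut: the
largest cost is at most the cut of one of its endpoints, and a cut separates at most `n ^ 2 / 4`
pairs.

A star needs four pulses, so an unweighted graph needs at most `4 * n`, and there are
`O(log (n / ε))` binary digits. Compiling edge by edge instead needs at most 12 operations per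
sampled edge.
-/

section Cuts

variable {V : Type*}

/-- The indicator function of the edges that cross the cut `S`. -/
def cutIndicator [DecidableEq V] (S : Finset V) : Sym2 V → ℝ :=
  Sym2.lift ⟨fun u v => if (u ∈ S ↔ v ∈ S) then 0 else 1, fun u v => by simp only [iff_comm]⟩

theorem cutIndicator_mk [DecidableEq V] (S : Finset V) (u v : V) :
    cutIndicator S s(u, v) = if (u ∈ S ↔ v ∈ S) then 0 else 1 := rfl

theorem cutIndicator_nonneg [DecidableEq V] (S : Finset V) (e : Sym2 V) :
    0 ≤ cutIndicator S e := by
  induction e using Sym2.ind with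
  | _ u v => rw [cutIndicator_mk]; split_ifs <;> norm_num

theorem cutIndicator_le_one [DecidableEq V] (S : Finset V) (e : Sym2 V) :
    cutIndicator S e ≤ 1 := by
  induction e using Sym2.ind with
  | _ u v => rw [cutIndicator_mk]; split_ifs <;> norm_num

variable [Fintype V]

theorem sum_cutIndicator [DecidableEq V] {u v : V} (huv : u ≠ v) :
    ∑ S : Finset V, cutIndicator S s(u, v) = 2 ^ Fintype.card V / 2 := by
  have toggle : ∀ S : Finset V,
      cutIndicator (symmDiff S {u}) s(u, v) = 1 - cutIndicator S s(u, v) := fun S => by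
    simp only [cutIndicator_mk, Finset.mem_symmDiff, Finset.mem_singleton]
    by_cases hu : u ∈ S <;> by_cases hv : v ∈ S <;> simp [hu, hv, huv.symm]
  have invariant : ∑ S : Finset V, cutIndicator (symmDiff S {u}) s(u, v) =
      ∑ S, cutIndicator S s(u, v) :=
    (symmDiff_left_involutive ({u} : Finset V)).bijective.sum_comp fun S => cutIndicator S s(u, v)
  simp only [toggle, Finset.sum_sub_distrib, Finset.sum_const, Finset.card_univ,
    Fintype.card_finset, nsmul_eq_mul, mul_one] at invariant
  push_cast at invariant
  linarith

theorem sum_sum_sym2Mk {g : Sym2 V → ℝ} (hg : ∀ u, g s(u, u) = 0) :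
    ∑ u, ∑ v, g s(u, v) = 2 * ∑ e, g e := by
  classical
  rw [← Fintype.sum_prod_type', ← Finset.sum_fiberwise _ fun x : V × V => s(x.1, x.2),
    Finset.mul_sum]
  refine Finset.sum_congr rfl fun e _ => ?_
  rw [Finset.sum_congr rfl fun x hx => congrArg g (Finset.mem_filter.1 hx).2, Finset.sum_const,
    nsmul_eq_mul]
  induction e using Sym2.ind with
  | _ u v =>
    rcases eq_or_ne u v with rfl | huv
    · rw [hg, mul_zero, mul_zero]
    · have fiber : Finset.univ.filter (fun x : V × V => s(x.1, x.2) = s(u, v)) =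
          {(u, v), (v, u)} := by
        ext ⟨a, b⟩
        simp
      rw [fiber, Finset.card_pair (by simp [huv]), Nat.cast_ofNat]

end Cuts

namespace WGraph

variable {n : ℕ} {G : WGraph n}

theorem cost_diag (G : WGraph n) (u : Fin n) : G.cost s(u, u) = 0 :=
  G.cost_of_notMem _ fun h => G.graph.not_isDiag_of_mem_edgeSet h rfl

theorem cut_eq_sum_cutIndicator (G : WGraph n) (S : Finset (Fin n)) :
    G.cut S = ∑ e, cutIndicator S e * G.cost e := by
  have ordered : G.cut S = ∑ u, ∑ v, if u ∈ S ∧ v ∉ S then G.cost s(u, v) else 0 := by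
    simp only [cut, ite_and, Finset.sum_ite_mem, Finset.sum_ite_irrel, Finset.sum_const_zero,
      Finset.univ_inter, ← Finset.mem_compl]
  have swapped : G.cut S = ∑ u, ∑ v, if v ∈ S ∧ u ∉ S then G.cost s(u, v) else 0 := by
    rw [ordered, Finset.sum_comm]
    simp only [Sym2.eq_swap]
  have symmetrized : G.cut S + G.cut S = ∑ u, ∑ v, cutIndicator S s(u, v) * G.cost s(u, v) := by
    nth_rewrite 2 [swapped]
    simp only [ordered, ← Finset.sum_add_distrib, cutIndicator_mk]
    refine Finset.sum_congr rfl fun u _ => Finset.sum_congr rfl fun v _ => ?_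
    by_cases hu : u ∈ S <;> by_cases hv : v ∈ S <;> simp [hu, hv]
  rw [sum_sum_sym2Mk (g := fun e => cutIndicator S e * G.cost e)
    fun u => by rw [cost_diag, mul_zero]] at symmetrized
  linarith

theorem Nonneg.totalCost_nonneg (hG : G.Nonneg) : 0 ≤ G.totalCost :=
  Finset.sum_nonneg fun e _ => hG e

theorem Nonneg.cut_nonneg (hG : G.Nonneg) (S : Finset (Fin n)) : 0 ≤ G.cut S :=
  Finset.sum_nonneg fun _ _ => Finset.sum_nonneg fun _ _ => hG _

theorem Nonneg.cut_le_totalCost (hG : G.Nonneg) (S : Finset (Fin n)) :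
    G.cut S ≤ G.totalCost := by
  rw [cut_eq_sum_cutIndicator]
  exact Finset.sum_le_sum fun e _ => mul_le_of_le_one_left (hG e) (cutIndicator_le_one S e)

theorem sum_cut (G : WGraph n) : ∑ S, G.cut S = 2 ^ n / 2 * G.totalCost := by
  simp only [cut_eq_sum_cutIndicator]
  rw [Finset.sum_comm, totalCost, Finset.mul_sum]
  refine Finset.sum_congr rfl fun e _ => ?_
  rw [← Finset.sum_mul]
  induction e using Sym2.ind with
  | _ u v =>
    rcases eq_or_ne u v with rfl | huv
    · rw [cost_diag, mul_zero, mul_zero]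
    · rw [sum_cutIndicator huv, Fintype.card_fin]

theorem exists_totalCost_div_two_le_cut (G : WGraph n) : ∃ S, G.totalCost / 2 ≤ G.cut S := by
  have average : ∑ _S : Finset (Fin n), G.totalCost / 2 ≤ ∑ S, G.cut S := by
    rw [sum_cut, Finset.sum_const, Finset.card_univ, Fintype.card_finset, Fintype.card_fin,
      nsmul_eq_mul, Nat.cast_pow, Nat.cast_ofNat]
    exact (by ring : (2 : ℝ) ^ n * (G.totalCost / 2) = 2 ^ n / 2 * G.totalCost).le
  obtain ⟨S, -, hS⟩ := Finset.exists_le_of_sum_le Finset.univ_nonempty average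
  exact ⟨S, hS⟩

/-- The weighted degree of `u`. -/
def wdeg (G : WGraph n) (u : Fin n) : ℝ := ∑ v, G.cost s(u, v)

theorem wdeg_eq_cut (G : WGraph n) (u : Fin n) : G.wdeg u = G.cut {u} := by
  rw [wdeg, cut, Finset.sum_singleton, ← Finset.sum_compl_add_sum {u}, Finset.sum_singleton,
    cost_diag, add_zero]

theorem sum_wdeg (G : WGraph n) : ∑ u, G.wdeg u = 2 * G.totalCost :=
  sum_sum_sym2Mk G.cost_diag

theorem Nonneg.wdeg_nonneg (hG : G.Nonneg) (u : Fin n) : 0 ≤ G.wdeg u :=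
  Finset.sum_nonneg fun _ _ => hG _

theorem Nonneg.wdeg_le_totalCost (hG : G.Nonneg) (u : Fin n) : G.wdeg u ≤ G.totalCost :=
  G.wdeg_eq_cut u ▸ hG.cut_le_totalCost {u}

theorem Nonneg.cost_le_wdeg (hG : G.Nonneg) (u v : Fin n) : G.cost s(u, v) ≤ G.wdeg u :=
  Finset.single_le_sum (f := fun v => G.cost s(u, v)) (fun _ _ => hG _) (Finset.mem_univ v)

end WGraph

section SpectralSolution

open scoped Matrix

variable {ι : Type*} [Fintype ι]

theorem sq_dotProduct_mulVec_le {A : Matrix ι ι ℝ} (hA : A.PosSemidef) (x y : ι → ℝ) :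
    (x ⬝ᵥ A *ᵥ y) ^ 2 ≤ (x ⬝ᵥ A *ᵥ x) * (y ⬝ᵥ A *ᵥ y) := by
  classical
  have symm : y ⬝ᵥ A *ᵥ x = x ⬝ᵥ A *ᵥ y := by
    rw [Matrix.dotProduct_mulVec, ← Matrix.mulVec_transpose, Matrix.isHermitian_iff_isSymm.1 hA.1,
      dotProduct_comm]
  have cauchySchwarz := LinearMap.BilinForm.apply_mul_apply_le_of_forall_zero_le
    (Matrix.toLinearMap₂' ℝ A) (fun z => by
      rw [Matrix.toLinearMap₂'_apply']
      simpa only [star_trivial] using hA.dotProduct_mulVec_nonneg z) x y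
  simpa only [Matrix.toLinearMap₂'_apply', symm, ← sq] using cauchySchwarz

variable [DecidableEq ι] {A : Matrix ι ι ℝ}

/-- The vector `A⁺ x`, where `A⁺` is the Moore–Penrose inverse of the symmetric matrix `A`, in
terms of the eigenvectors of `A`. The eigenvalue `0` contributes nothing because `x / 0 = 0`. -/
noncomputable def spectralSolution (hA : A.IsHermitian) (x : ι → ℝ) : ι → ℝ :=
  ∑ i, (x ⬝ᵥ hA.eigenvectorBasis i / hA.eigenvalues i) • (hA.eigenvectorBasis i).ofLp

theorem sum_dotProduct_eigenvectorBasis_smul (hA : A.IsHermitian) (x : ι → ℝ) :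
    ∑ i, (x ⬝ᵥ hA.eigenvectorBasis i) • (hA.eigenvectorBasis i).ofLp = x := by
  have expansion := congrArg WithLp.ofLp (hA.eigenvectorBasis.sum_repr' (WithLp.toLp 2 x))
  simpa only [WithLp.ofLp_sum, WithLp.ofLp_smul, EuclideanSpace.inner_eq_star_dotProduct,
    star_trivial] using expansion

theorem dotProduct_eigenvectorBasis_self (hA : A.IsHermitian) (i : ι) :
    hA.eigenvectorBasis i ⬝ᵥ hA.eigenvectorBasis i = 1 := by
  have normalized := real_inner_self_eq_norm_sq (hA.eigenvectorBasis i)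
  rwa [hA.eigenvectorBasis.orthonormal.1 i, one_pow, EuclideanSpace.inner_eq_star_dotProduct,
    star_trivial] at normalized

theorem mulVec_spectralSolution (hA : A.IsHermitian) {x : ι → ℝ}
    (hx : ∀ y, A *ᵥ y = 0 → x ⬝ᵥ y = 0) : A *ᵥ spectralSolution hA x = x := by
  nth_rewrite 2 [← sum_dotProduct_eigenvectorBasis_smul hA x]
  rw [spectralSolution, Matrix.mulVec_sum]
  refine Finset.sum_congr rfl fun i _ => ?_
  have eigen := hA.mulVec_eigenvectorBasis i
  rw [Matrix.mulVec_smul, eigen, smul_smul]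
  by_cases hi : hA.eigenvalues i = 0
  · rw [hx _ (by rw [eigen, hi, zero_smul]), zero_div, zero_mul]
  · rw [div_mul_cancel₀ _ hi]

theorem dotProduct_spectralSolution (hA : A.IsHermitian) (x : ι → ℝ) :
    x ⬝ᵥ spectralSolution hA x =
      ∑ i, (x ⬝ᵥ hA.eigenvectorBasis i) ^ 2 / hA.eigenvalues i := by
  rw [spectralSolution, dotProduct_sum]
  refine Finset.sum_congr rfl fun i _ => ?_
  rw [dotProduct_smul, smul_eq_mul, div_mul_eq_mul_div, sq]

end SpectralSolution

namespace WGraph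

open scoped Matrix

variable {n : ℕ} {G : WGraph n} {u v : Fin n} {φ : Fin n → ℝ}

/-- The weighted Laplacian, whose entry at a vertex is the weighted degree and whose entry at a
pair of distinct vertices is minus the cost of that pair. -/
def laplacian (G : WGraph n) : Matrix (Fin n) (Fin n) ℝ :=
  Matrix.diagonal G.wdeg - Matrix.of fun u v => G.cost s(u, v)

theorem laplacian_mulVec (G : WGraph n) (φ : Fin n → ℝ) (w : Fin n) :
    (G.laplacian *ᵥ φ) w = ∑ x, G.cost s(w, x) * (φ w - φ x) := by
  rw [laplacian, Matrix.sub_mulVec, Pi.sub_apply, Matrix.mulVec_diagonal, wdeg, Finset.sum_mul]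
  simp only [Matrix.mulVec, dotProduct, Matrix.of_apply, mul_sub, Finset.sum_sub_distrib]

theorem isUnitFlow_iff :
    G.IsUnitFlow u v φ ↔ G.laplacian *ᵥ φ = Pi.single u 1 - Pi.single v 1 := by
  simp only [IsUnitFlow, funext_iff, laplacian_mulVec, Pi.sub_apply, Pi.single_apply]

theorem two_mul_dotProduct_laplacian_mulVec (G : WGraph n) (f g : Fin n → ℝ) :
    2 * (f ⬝ᵥ G.laplacian *ᵥ g) = ∑ u, ∑ v, G.cost s(u, v) * ((f u - f v) * (g u - g v)) := by
  have expanded : f ⬝ᵥ G.laplacian *ᵥ g = ∑ u, ∑ v, G.cost s(u, v) * (f u * (g u - g v)) := by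
    simp only [dotProduct, laplacian_mulVec, Finset.mul_sum, mul_left_comm]
  have swapped : f ⬝ᵥ G.laplacian *ᵥ g = ∑ u, ∑ v, G.cost s(u, v) * (f v * (g v - g u)) := by
    rw [expanded, Finset.sum_comm]
    simp only [Sym2.eq_swap]
  rw [two_mul]
  nth_rewrite 2 [swapped]
  simp only [expanded, ← Finset.sum_add_distrib]
  exact Finset.sum_congr rfl fun u _ => Finset.sum_congr rfl fun v _ => by ring

theorem laplacian_isHermitian (G : WGraph n) : G.laplacian.IsHermitian :=
  (Matrix.isHermitian_diagonal G.wdeg).sub (Matrix.IsHermitian.ext fun u v => by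
    rw [Matrix.of_apply, Matrix.of_apply, star_trivial, Sym2.eq_swap])

theorem Nonneg.laplacian_posSemidef (hG : G.Nonneg) : G.laplacian.PosSemidef := by
  refine .of_dotProduct_mulVec_nonneg G.laplacian_isHermitian fun f => ?_
  have dirichlet := G.two_mul_dotProduct_laplacian_mulVec f f
  have energy : 0 ≤ ∑ u, ∑ v, G.cost s(u, v) * ((f u - f v) * (f u - f v)) :=
    Finset.sum_nonneg fun u _ => Finset.sum_nonneg fun v _ =>
      mul_nonneg (hG _) (mul_self_nonneg _)
  rw [star_trivial]
  linarith

theorem Nonneg.eq_of_laplacian_mulVec_eq_zero (hG : G.Nonneg) {f : Fin n → ℝ}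
    (hf : G.laplacian *ᵥ f = 0) (huv : G.cost s(u, v) ≠ 0) : f u = f v := by
  have dirichlet := G.two_mul_dotProduct_laplacian_mulVec f f
  rw [hf, dotProduct_zero, mul_zero, eq_comm] at dirichlet
  have nonneg : ∀ u v, 0 ≤ G.cost s(u, v) * ((f u - f v) * (f u - f v)) := fun u v =>
    mul_nonneg (hG _) (mul_self_nonneg _)
  rw [Finset.sum_eq_zero_iff_of_nonneg fun u _ => Finset.sum_nonneg fun v _ => nonneg u v]
    at dirichlet
  have row := dirichlet u (Finset.mem_univ u)
  rw [Finset.sum_eq_zero_iff_of_nonneg fun v _ => nonneg u v] at row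
  exact sub_eq_zero.1 <| mul_self_eq_zero.1 <|
    (mul_eq_zero.1 (row v (Finset.mem_univ v))).resolve_left huv

/-- Vertex potentials that drive a unit current from `u` to `v`, provided that such potentials
exist. -/
noncomputable def unitPotential (G : WGraph n) (u v : Fin n) : Fin n → ℝ :=
  spectralSolution G.laplacian_isHermitian (Pi.single u 1 - Pi.single v 1)

theorem Nonneg.isUnitFlow_unitPotential (hG : G.Nonneg) (huv : G.cost s(u, v) ≠ 0) :
    G.IsUnitFlow u v (G.unitPotential u v) :=
  isUnitFlow_iff.2 <| mulVec_spectralSolution _ fun f hf => by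
    rw [sub_dotProduct, single_one_dotProduct, single_one_dotProduct,
      hG.eq_of_laplacian_mulVec_eq_zero hf huv, sub_self]

theorem IsUnitFlow.effectiveResistance_eq (hφ : G.IsUnitFlow u v φ) :
    G.effectiveResistance s(u, v) = φ u - φ v := by
  have value : G.IsEffectiveResistance s(u, v) (φ u - φ v) := ⟨u, v, φ, rfl, hφ, rfl⟩
  have attained : ∃ r, G.IsEffectiveResistance s(u, v) r := ⟨_, value⟩
  rw [effectiveResistance, dif_pos attained]
  exact attained.choose_spec.unique value

theorem IsUnitFlow.one_le_wdeg_mul_effectiveResistance (hφ : G.IsUnitFlow u v φ)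
    (hG : G.Nonneg) (huv : u ≠ v) : 1 ≤ G.wdeg u * G.effectiveResistance s(u, v) := by
  have flow := isUnitFlow_iff.1 hφ
  have self : Pi.single u 1 ⬝ᵥ G.laplacian *ᵥ Pi.single u 1 = G.wdeg u := by
    rw [single_one_dotProduct, Matrix.mulVec_single_one, Matrix.col_apply, laplacian,
      Matrix.sub_apply, Matrix.diagonal_apply_eq, Matrix.of_apply, cost_diag, sub_zero]
  have cross : Pi.single u 1 ⬝ᵥ G.laplacian *ᵥ φ = 1 := by
    rw [flow, single_one_dotProduct, Pi.sub_apply, Pi.single_eq_same, Pi.single_eq_of_ne huv,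
      sub_zero]
  have energy : φ ⬝ᵥ G.laplacian *ᵥ φ = G.effectiveResistance s(u, v) := by
    rw [flow, dotProduct_sub, dotProduct_single_one, dotProduct_single_one,
      hφ.effectiveResistance_eq]
  simpa only [self, cross, energy, one_pow] using
    sq_dotProduct_mulVec_le hG.laplacian_posSemidef (Pi.single u 1) φ

theorem ne_of_cost_ne_zero (huv : G.cost s(u, v) ≠ 0) : u ≠ v := by
  rintro rfl
  exact huv (G.cost_diag u)

theorem Nonneg.one_le_wdeg_mul_effectiveResistance (hG : G.Nonneg) (huv : G.cost s(u, v) ≠ 0) :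
    1 ≤ G.wdeg u * G.effectiveResistance s(u, v) :=
  (hG.isUnitFlow_unitPotential huv).one_le_wdeg_mul_effectiveResistance hG (ne_of_cost_ne_zero huv)

theorem Nonneg.cost_mul_effectiveResistance (hG : G.Nonneg) (u v : Fin n) :
    G.cost s(u, v) * G.effectiveResistance s(u, v) =
      ∑ i, G.cost s(u, v) *
        (G.laplacian_isHermitian.eigenvectorBasis i u -
          G.laplacian_isHermitian.eigenvectorBasis i v) ^ 2 /
        G.laplacian_isHermitian.eigenvalues i := by
  by_cases huv : G.cost s(u, v) = 0
  · simp only [huv, zero_mul, zero_div, Finset.sum_const_zero]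
  · have quadratic := dotProduct_spectralSolution G.laplacian_isHermitian
      (Pi.single u 1 - Pi.single v 1)
    simp only [sub_dotProduct, single_one_dotProduct] at quadratic
    rw [(hG.isUnitFlow_unitPotential huv).effectiveResistance_eq, unitPotential, quadratic,
      Finset.mul_sum]
    simp only [mul_div_assoc]

theorem Nonneg.sum_cost_mul_effectiveResistance_le (hG : G.Nonneg) :
    ∑ e, G.cost e * G.effectiveResistance e ≤ n := by
  have hL := G.laplacian_isHermitian
  have trace : ∀ i, ∑ u, ∑ v, G.cost s(u, v) *
      (hL.eigenvectorBasis i u - hL.eigenvectorBasis i v) ^ 2 = 2 * hL.eigenvalues i := fun i => by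
    simp only [sq, ← two_mul_dotProduct_laplacian_mulVec, hL.mulVec_eigenvectorBasis,
      dotProduct_smul, dotProduct_eigenvectorBasis_self, smul_eq_mul, mul_one]
  have foster : 2 * ∑ e, G.cost e * G.effectiveResistance e ≤ 2 * n := by
    calc 2 * ∑ e, G.cost e * G.effectiveResistance e
        = ∑ u, ∑ v, G.cost s(u, v) * G.effectiveResistance s(u, v) :=
          (sum_sum_sym2Mk (g := fun e => G.cost e * G.effectiveResistance e)
            fun u => by rw [cost_diag, zero_mul]).symm
      _ = ∑ i, 2 * (hL.eigenvalues i / hL.eigenvalues i) := by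
          simp only [hG.cost_mul_effectiveResistance]
          rw [Finset.sum_congr rfl fun u _ => Finset.sum_comm, Finset.sum_comm]
          simp only [← Finset.sum_div, trace, ← mul_div_assoc]
      _ ≤ ∑ _i : Fin n, (2 : ℝ) :=
          Finset.sum_le_sum fun i _ => mul_le_of_le_one_right zero_le_two (div_self_le_one _)
      _ = 2 * n := by rw [Finset.sum_const, Finset.card_univ, Fintype.card_fin, nsmul_eq_mul,
          mul_comm]
  linarith

theorem Nonneg.cost_mul_effectiveResistance_pos (hG : G.Nonneg) {e : Sym2 (Fin n)}
    (he : G.cost e ≠ 0) : 0 < G.cost e * G.effectiveResistance e := by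
  induction e using Sym2.ind with
  | _ u v =>
    have product_pos := zero_lt_one.trans_le (hG.one_le_wdeg_mul_effectiveResistance he)
    exact mul_pos ((hG _).lt_of_ne' he) (pos_of_mul_pos_right product_pos (hG.wdeg_nonneg u))

theorem Nonneg.cost_mul_effectiveResistance_nonneg (hG : G.Nonneg) (e : Sym2 (Fin n)) :
    0 ≤ G.cost e * G.effectiveResistance e := by
  by_cases he : G.cost e = 0
  · rw [he, zero_mul]
  · exact (hG.cost_mul_effectiveResistance_pos he).le

theorem Nonneg.tsum_leverage (hG : G.Nonneg) :
    ∑' e, G.leverage e = ENNReal.ofReal (∑ e, G.cost e * G.effectiveResistance e) := by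
  rw [tsum_fintype, ENNReal.ofReal_sum_of_nonneg
    fun e _ => hG.cost_mul_effectiveResistance_nonneg e]
  rfl

theorem Nonneg.edgeDist_toReal (hG : G.Nonneg) (h : ∑' e, G.leverage e ≠ 0) (e : Sym2 (Fin n)) :
    (G.edgeDist h e).toReal =
      G.cost e * G.effectiveResistance e / ∑ e, G.cost e * G.effectiveResistance e := by
  rw [edgeDist, PMF.normalize_apply, hG.tsum_leverage, leverage, ENNReal.toReal_mul,
    ENNReal.toReal_inv, ENNReal.toReal_ofReal (hG.cost_mul_effectiveResistance_nonneg e),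
    ENNReal.toReal_ofReal (Finset.sum_nonneg fun e _ => hG.cost_mul_effectiveResistance_nonneg e),
    div_eq_mul_inv]

theorem Nonneg.cost_le_edgeDist (hG : G.Nonneg) (h : ∑' e, G.leverage e ≠ 0) (u v : Fin n) :
    G.cost s(u, v) ≤ n * G.wdeg u * (G.edgeDist h s(u, v)).toReal := by
  by_cases huv : G.cost s(u, v) = 0
  · rw [huv]
    exact mul_nonneg (mul_nonneg n.cast_nonneg (hG.wdeg_nonneg u)) ENNReal.toReal_nonneg
  have total_pos : 0 < ∑ e, G.cost e * G.effectiveResistance e := by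
    rwa [hG.tsum_leverage, Ne, ENNReal.ofReal_eq_zero, not_le] at h
  rw [hG.edgeDist_toReal, mul_div_assoc', le_div_iff₀ total_pos]
  calc G.cost s(u, v) * ∑ e, G.cost e * G.effectiveResistance e
      ≤ G.cost s(u, v) * n :=
        mul_le_mul_of_nonneg_left hG.sum_cost_mul_effectiveResistance_le (hG _)
    _ ≤ G.cost s(u, v) * n * (G.wdeg u * G.effectiveResistance s(u, v)) :=
        le_mul_of_one_le_right (mul_nonneg (hG _) n.cast_nonneg)
          (hG.one_le_wdeg_mul_effectiveResistance huv)
    _ = n * G.wdeg u * (G.cost s(u, v) * G.effectiveResistance s(u, v)) := by ring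

theorem Nonneg.cost_eq_zero_of_tsum_leverage_eq_zero (hG : G.Nonneg)
    (h : ∑' e, G.leverage e = 0) (e : Sym2 (Fin n)) : G.cost e = 0 := by
  by_contra he
  exact (ENNReal.ofReal_pos.2 (hG.cost_mul_effectiveResistance_pos he)).ne'
    (ENNReal.tsum_eq_zero.1 h e)

end WGraph

section Concentration

open MeasureTheory ProbabilityTheory

variable {Ω ι : Type*} {mΩ : MeasurableSpace Ω} {P : Measure Ω} {b c s M : ℝ}

theorem mgf_le_exp_of_mem_Icc [IsProbabilityMeasure P] {X : Ω → ℝ} (hX : AEMeasurable X P)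
    (hXb : ∀ᵐ ω ∂P, X ω ∈ Set.Icc 0 b) (hc : |c| * b ≤ 1) :
    mgf X P c ≤ Real.exp ((c + c ^ 2 * b) * ∫ ω, X ω ∂P) := by
  have integrable : Integrable X P := .of_mem_Icc 0 b hX hXb
  have pointwise : ∀ᵐ ω ∂P, Real.exp (c * X ω) ≤ 1 + (c + c ^ 2 * b) * X ω := by
    filter_upwards [hXb] with ω hω
    have small : |c * X ω| ≤ 1 := by
      rw [abs_mul, abs_of_nonneg hω.1]
      exact (mul_le_mul_of_nonneg_left hω.2 (abs_nonneg c)).trans hc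
    have remainder := (abs_le.1 (Real.abs_exp_sub_one_sub_id_le small)).2
    have square_le : c ^ 2 * (X ω * X ω) ≤ c ^ 2 * (b * X ω) :=
      mul_le_mul_of_nonneg_left (mul_le_mul_of_nonneg_right hω.2 hω.1) (sq_nonneg c)
    linarith [mul_pow c (X ω) 2]
  calc mgf X P c ≤ ∫ ω, 1 + (c + c ^ 2 * b) * X ω ∂P :=
        integral_mono_ae (integrable_exp_mul_of_mem_Icc hX hXb)
          ((integrable_const 1).add (integrable.const_mul _)) pointwise
    _ = (c + c ^ 2 * b) * (∫ ω, X ω ∂P) + 1 := by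
        rw [integral_add (integrable_const 1) (integrable.const_mul _), integral_const_mul,
          integral_const, probReal_univ, one_smul, add_comm]
    _ ≤ Real.exp ((c + c ^ 2 * b) * ∫ ω, X ω ∂P) := Real.add_one_le_exp _

variable [Fintype ι] {X : ι → Ω → ℝ}

theorem mgf_sum_le_exp_of_mem_Icc (hX : ∀ i, Measurable (X i)) (hindep : iIndepFun X P)
    (hXb : ∀ i, ∀ᵐ ω ∂P, X i ω ∈ Set.Icc 0 b) (hc : |c| * b ≤ 1) :
    mgf (∑ i, X i) P c ≤ Real.exp ((c + c ^ 2 * b) * ∑ i, ∫ ω, X i ω ∂P) := by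
  have := hindep.isProbabilityMeasure
  rw [hindep.mgf_sum hX, Finset.mul_sum, Real.exp_sum]
  exact Finset.prod_le_prod (fun i _ => mgf_nonneg)
    fun i _ => mgf_le_exp_of_mem_Icc (hX i).aemeasurable (hXb i) hc

theorem measureReal_abs_sum_sub_ge_le (hX : ∀ i, Measurable (X i)) (hindep : iIndepFun X P)
    (hXb : ∀ i, ∀ᵐ ω ∂P, X i ω ∈ Set.Icc 0 b) (hb : 0 < b) (hM : ∑ i, ∫ ω, X i ω ∂P ≤ M)
    (hs : 0 < s) (hsM : s ≤ M) :
    P.real {ω | s ≤ |∑ i, X i ω - ∑ i, ∫ ω, X i ω ∂P|} ≤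
      2 * Real.exp (-(s ^ 2 / (4 * b * M))) := by
  have := hindep.isProbabilityMeasure
  set m := ∑ i, ∫ ω, X i ω ∂P
  have hM_pos : 0 < M := hs.trans_le hsM
  -- The minimizer of the exponent `-c s + c² b M`.
  set c := s / (2 * b * M) with hc
  have hc_nonneg : 0 ≤ c := by positivity
  have hcb : c * b ≤ 1 := by
    rw [hc, div_mul_eq_mul_div, div_le_one (by positivity)]
    nlinarith
  have exponent : -(c * s) + c ^ 2 * b * m ≤ -(s ^ 2 / (4 * b * M)) :=
    calc -(c * s) + c ^ 2 * b * m ≤ -(c * s) + c ^ 2 * b * M := by gcongr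
      _ = -(s ^ 2 / (4 * b * M)) := by rw [hc]; field_simp; ring
  have integrable : ∀ d, Integrable (fun ω => Real.exp (d * (∑ i, X i) ω)) P := fun d =>
    hindep.integrable_exp_mul_sum hX fun i _ =>
      integrable_exp_mul_of_mem_Icc (hX i).aemeasurable (hXb i)
  have upper : P.real {ω | m + s ≤ (∑ i, X i) ω} ≤ Real.exp (-(s ^ 2 / (4 * b * M))) := by
    refine (measure_ge_le_exp_mul_mgf _ hc_nonneg (integrable c)).trans ?_
    refine (mul_le_mul_of_nonneg_left (mgf_sum_le_exp_of_mem_Icc hX hindep hXb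
      (by rwa [abs_of_nonneg hc_nonneg])) (Real.exp_pos _).le).trans ?_
    rw [← Real.exp_add, Real.exp_le_exp]
    linarith
  have lower : P.real {ω | (∑ i, X i) ω ≤ m - s} ≤ Real.exp (-(s ^ 2 / (4 * b * M))) := by
    refine (measure_le_le_exp_mul_mgf _ (neg_nonpos.2 hc_nonneg) (integrable (-c))).trans ?_
    refine (mul_le_mul_of_nonneg_left (mgf_sum_le_exp_of_mem_Icc hX hindep hXb
      (by rwa [abs_neg, abs_of_nonneg hc_nonneg])) (Real.exp_pos _).le).trans ?_
    rw [← Real.exp_add, Real.exp_le_exp, neg_sq]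
    linarith
  have subset : {ω | s ≤ |∑ i, X i ω - m|} ⊆
      {ω | m + s ≤ (∑ i, X i) ω} ∪ {ω | (∑ i, X i) ω ≤ m - s} := fun ω hω => by
    simp only [Set.mem_union, Set.mem_ofPred_eq, Finset.sum_apply, le_abs] at hω ⊢
    exact hω.imp (fun h => by linarith) fun h => by linarith
  linarith [(measureReal_mono subset).trans (measureReal_union_le (μ := P) _ _)]

end Concentration

section ImportanceSampling

open MeasureTheory ProbabilityTheory

variable {α : Type*} [Fintype α]

theorem iidDist_toMeasure [MeasurableSpace α] [MeasurableSingletonClass α] (p : PMF α) (q : ℕ) :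
    (WGraph.iidDist p q).toMeasure = Measure.pi fun _ => p.toMeasure := by
  refine Measure.ext_of_singleton fun ω => ?_
  rw [PMF.toMeasure_apply_singleton _ _ (measurableSet_singleton ω), Measure.pi_singleton]
  simp only [PMF.toMeasure_apply_singleton _ _ (measurableSet_singleton _), WGraph.iidDist,
    PMF.ofFintype_apply]

/-- The estimate of `∑ a, g a` from the samples `ω`, each sample `a` of which has been drawn with
probability `p a`. -/
noncomputable def importanceSum (p : PMF α) (g : α → ℝ) {q : ℕ} (ω : Fin q → α) : ℝ :=
  ∑ t, g (ω t) / (q * (p (ω t)).toReal)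

variable {p : PMF α} {q : ℕ} {g : α → ℝ} {b s M : ℝ}

theorem iidDist_abs_importanceSum_sub_ge_le (hg : ∀ a, 0 ≤ g a)
    (hgb : ∀ a, g a ≤ b * (q * (p a).toReal)) (hb : 0 < b) (hM : ∑ a, g a ≤ M) (hs : 0 < s)
    (hsM : s ≤ M) :
    (WGraph.iidDist p q).toOuterMeasure {ω | s ≤ |importanceSum p g ω - ∑ a, g a|} ≤
      ENNReal.ofReal (2 * Real.exp (-(s ^ 2 / (4 * b * M)))) := by
  let _ : MeasurableSpace α := ⊤
  set f : α → ℝ := fun a => g a / (q * (p a).toReal)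
  have f_mem : ∀ a, f a ∈ Set.Icc 0 b := fun a =>
    ⟨div_nonneg (hg a) (by positivity), div_le_of_le_mul₀ (by positivity) hb.le (hgb a)⟩
  have unbiased : ∑ t : Fin q, ∫ ω : Fin q → α, f (ω t) ∂Measure.pi (fun _ => p.toMeasure) =
      ∑ a, g a := by
    have marginal : ∀ t : Fin q, ∫ ω : Fin q → α, f (ω t) ∂Measure.pi (fun _ => p.toMeasure) =
        ∑ a, (p a).toReal * f a := fun t => by
      rw [integral_comp_eval (μ := fun _ => p.toMeasure) (i := t) (f := f)
        (Measurable.of_discrete (f := f)).aestronglyMeasurable, PMF.integral_eq_sum]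
      simp only [smul_eq_mul]
    simp only [marginal, Finset.sum_const, Finset.card_univ, Fintype.card_fin, nsmul_eq_mul,
      Finset.mul_sum]
    refine Finset.sum_congr rfl fun a _ => ?_
    rw [← mul_assoc]
    exact mul_div_cancel_of_imp' fun h => le_antisymm (by simpa only [h, mul_zero] using hgb a)
      (hg a)
  have tail := measureReal_abs_sum_sub_ge_le (X := fun (t : Fin q) ω => f (ω t))
    (P := Measure.pi fun _ => p.toMeasure) (fun _ => by fun_prop)
    (iIndepFun_pi fun _ => (Measurable.of_discrete (f := f)).aemeasurable)
    (fun _ => .of_forall fun _ => f_mem _) hb (unbiased.trans_le hM) hs hsM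
  rw [unbiased, ← iidDist_toMeasure] at tail
  rw [← PMF.toMeasure_apply_eq_toOuterMeasure, ← ofReal_measureReal]
  exact ENNReal.ofReal_le_ofReal tail

theorem WGraph.cut_sampledGraph {n : ℕ} (G : WGraph n) (p : PMF (Sym2 (Fin n)))
    (ω : Fin q → Sym2 (Fin n)) (S : Finset (Fin n)) :
    (G.sampledGraph p ω).cut S = importanceSum p (fun e => cutIndicator S e * G.cost e) ω := by
  rw [cut_eq_sum_cutIndicator, importanceSum]
  simp only [sampledGraph, Finset.mul_sum]
  rw [Finset.sum_comm]
  refine Finset.sum_congr rfl fun t _ => ?_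
  simp only [mul_ite, mul_zero, Finset.sum_ite_eq, Finset.mem_univ, if_true, mul_div_assoc]

end ImportanceSampling

section DyadicLevels

open Classical in
/-- The `i` with `(1 / 2) ^ (i + 1) < x ≤ (1 / 2) ^ i` if `x ∈ ((1 / 2) ^ L, 1]`, and `L` for all
smaller `x`. -/
noncomputable def dyadicLevel (L : ℕ) (x : ℝ) : ℕ :=
  Nat.find (p := fun i => (1 / 2) ^ (i + 1) < x ∨ L ≤ i) ⟨L, Or.inr le_rfl⟩

variable {L : ℕ} {x : ℝ}

theorem dyadicLevel_le (L : ℕ) (x : ℝ) : dyadicLevel L x ≤ L :=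
  Nat.find_min' _ (Or.inr le_rfl)

theorem one_half_pow_lt_of_dyadicLevel_lt (h : dyadicLevel L x < L) :
    (1 / 2) ^ (dyadicLevel L x + 1) < x := by
  classical
  exact (Nat.find_spec (p := fun i => (1 / 2) ^ (i + 1) < x ∨ L ≤ i)
    ⟨L, Or.inr le_rfl⟩).resolve_right h.not_ge

theorem le_one_half_pow_dyadicLevel (hx : x ≤ 1) (L : ℕ) : x ≤ (1 / 2) ^ dyadicLevel L x := by
  classical
  rcases eq : dyadicLevel L x with - | i
  · simpa only [pow_zero] using hx
  · have not_found := Nat.find_min (p := fun i => (1 / 2) ^ (i + 1) < x ∨ L ≤ i)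
      ⟨L, Or.inr le_rfl⟩ (m := i) (i.lt_succ_self.trans_eq eq.symm)
    exact not_lt.1 (not_or.1 not_found).1

theorem card_dyadicLevel_le {ι : Type*} [Fintype ι] {w : ι → ℝ} (hw : ∀ v, 0 ≤ w v)
    (hsum : ∑ v, w v ≤ 2) (hL : Fintype.card ι ≤ 2 ^ L) (i : ℕ) :
    (Finset.univ.filter fun v => dyadicLevel L (w v) ≤ i).card ≤ 2 ^ (i + 2) := by
  rcases le_or_gt L i with hi | hi
  · exact (Finset.card_le_univ _).trans (hL.trans (Nat.pow_le_pow_right two_pos (by omega)))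
  set s := Finset.univ.filter fun v => dyadicLevel L (w v) ≤ i
  have large : ∀ v ∈ s, (1 / 2 : ℝ) ^ (i + 1) ≤ w v := fun v hv => by
    have level_le := (Finset.mem_filter.1 hv).2
    refine le_trans ?_ (one_half_pow_lt_of_dyadicLevel_lt (level_le.trans_lt hi)).le
    exact pow_le_pow_of_le_one (by norm_num) (by norm_num) (by omega)
  have card_mul_le : (s.card : ℝ) * (1 / 2) ^ (i + 1) ≤ 2 := by
    rw [← nsmul_eq_mul]
    exact (s.card_nsmul_le_sum _ _ large).trans
      ((Finset.sum_le_univ_sum_of_nonneg hw).trans hsum)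
  rw [one_div, inv_pow, ← div_eq_mul_inv, div_le_iff₀ (by positivity)] at card_mul_le
  rw [← Nat.cast_le (α := ℝ)]
  push_cast
  linarith [pow_succ (2 : ℝ) (i + 1)]

theorem clog_two_add_one_le {n : ℕ} (hn : 2 ≤ n) : (Nat.clog 2 n : ℝ) + 1 ≤ 5 * Real.log n := by
  have pow_le : (2 : ℝ) ^ (Nat.clog 2 n - 1) ≤ n := by
    exact_mod_cast (Nat.pow_pred_clog_lt_self one_lt_two hn).le
  have clog_pos : 1 ≤ Nat.clog 2 n := Nat.clog_pos one_lt_two hn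
  have log_le := Real.log_le_log (by positivity) pow_le
  rw [Real.log_pow, Nat.cast_sub clog_pos, Nat.cast_one] at log_le
  have log_two_le : Real.log 2 ≤ Real.log n := Real.log_le_log two_pos (by exact_mod_cast hn)
  have clog_sub_one_nonneg : (0 : ℝ) ≤ Nat.clog 2 n - 1 := sub_nonneg.2 (by exact_mod_cast clog_pos)
  linarith [mul_le_mul_of_nonneg_left Real.log_two_gt_d9.le clog_sub_one_nonneg, Real.log_two_gt_d9]

end DyadicLevels

namespace WGraph

variable {n : ℕ} {G : WGraph n}

/-- The scale of the weighted degree of `v`, relative to the total cost. -/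
noncomputable def vertexLevel (G : WGraph n) (v : Fin n) : ℕ :=
  dyadicLevel (Nat.clog 2 n) (G.wdeg v / G.totalCost)

/-- The larger one of the levels of the endpoints. -/
noncomputable def edgeLevel (G : WGraph n) : Sym2 (Fin n) → ℕ :=
  Sym2.lift ⟨fun u v => max (G.vertexLevel u) (G.vertexLevel v), fun _ _ => max_comm _ _⟩

theorem edgeLevel_mk (G : WGraph n) (u v : Fin n) :
    G.edgeLevel s(u, v) = max (G.vertexLevel u) (G.vertexLevel v) := rfl

theorem edgeLevel_le (G : WGraph n) (e : Sym2 (Fin n)) : G.edgeLevel e ≤ Nat.clog 2 n := by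
  induction e using Sym2.ind with
  | _ u v => exact max_le (dyadicLevel_le _ _) (dyadicLevel_le _ _)

theorem Nonneg.wdeg_le_of_vertexLevel (hG : G.Nonneg) (v : Fin n) :
    G.wdeg v ≤ G.totalCost / 2 ^ G.vertexLevel v := by
  have ratio_le := le_one_half_pow_dyadicLevel
    (div_le_one_of_le₀ (hG.wdeg_le_totalCost v) hG.totalCost_nonneg) (Nat.clog 2 n)
  rcases hG.totalCost_nonneg.eq_or_lt with h | h
  · simpa only [← h, zero_div] using hG.wdeg_le_totalCost v
  · rw [div_le_iff₀ h, one_div, inv_pow, mul_comm, ← div_eq_mul_inv] at ratio_le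
    exact ratio_le

theorem Nonneg.card_vertexLevel_le (hG : G.Nonneg) (i : ℕ) :
    (Finset.univ.filter fun v => G.vertexLevel v ≤ i).card ≤ 2 ^ (i + 2) := by
  refine card_dyadicLevel_le (fun v => div_nonneg (hG.wdeg_nonneg v) hG.totalCost_nonneg) ?_
    ((Fintype.card_fin n).trans_le (Nat.le_pow_clog one_lt_two n)) i
  rw [← Finset.sum_div, sum_wdeg]
  exact div_le_of_le_mul₀ hG.totalCost_nonneg zero_le_two le_rfl

/-- The costs of the edges of level `i`. -/
noncomputable def levelCost (G : WGraph n) (i : ℕ) (e : Sym2 (Fin n)) : ℝ :=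
  if G.edgeLevel e = i then G.cost e else 0

theorem Nonneg.levelCost_nonneg (hG : G.Nonneg) (i : ℕ) (e : Sym2 (Fin n)) :
    0 ≤ G.levelCost i e :=
  ite_nonneg (hG e) le_rfl

theorem sum_levelCost (G : WGraph n) (e : Sym2 (Fin n)) :
    ∑ i ∈ Finset.range (Nat.clog 2 n + 1), G.levelCost i e = G.cost e := by
  simp only [levelCost]
  rw [Finset.sum_ite_eq, if_pos (Finset.mem_range_succ_iff.2 (G.edgeLevel_le e))]

theorem cutIndicator_filter_mul_levelCost (G : WGraph n) (S : Finset (Fin n)) (i : ℕ)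
    (e : Sym2 (Fin n)) :
    cutIndicator (S.filter fun v => G.vertexLevel v ≤ i) e * G.levelCost i e =
      cutIndicator S e * G.levelCost i e := by
  by_cases he : G.edgeLevel e = i
  · induction e using Sym2.ind with
    | _ u v =>
      have hu : G.vertexLevel u ≤ i := he ▸ le_max_left _ _
      have hv : G.vertexLevel v ≤ i := he ▸ le_max_right _ _
      simp only [cutIndicator_mk, Finset.mem_filter, hu, hv, and_true]
  · simp only [levelCost, if_neg he, mul_zero]

/-- The number to which the errors of the cuts in the graph of the edges of level `i` are compared.
The last two terms balance the number of these cuts and the number of levels. -/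
noncomputable def levelBudget (G : WGraph n) (i : ℕ) : ℝ :=
  ∑ e, G.levelCost i e + G.totalCost / (Nat.clog 2 n + 1) + G.totalCost / 2 ^ i

theorem Nonneg.sum_levelBudget_le (hG : G.Nonneg) :
    ∑ i ∈ Finset.range (Nat.clog 2 n + 1), G.levelBudget i ≤ 4 * G.totalCost := by
  simp only [levelBudget, Finset.sum_add_distrib]
  have costs : ∑ i ∈ Finset.range (Nat.clog 2 n + 1), ∑ e, G.levelCost i e = G.totalCost := by
    rw [Finset.sum_comm]
    exact Finset.sum_congr rfl fun e _ => G.sum_levelCost e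
  have constants : ∑ _i ∈ Finset.range (Nat.clog 2 n + 1),
      G.totalCost / ((Nat.clog 2 n : ℝ) + 1) = G.totalCost := by
    rw [Finset.sum_const, Finset.card_range, nsmul_eq_mul]
    push_cast
    field_simp
  have geometric : ∑ i ∈ Finset.range (Nat.clog 2 n + 1), G.totalCost / 2 ^ i ≤
      G.totalCost * 2 := by
    have := sum_geometric_two_le (Nat.clog 2 n + 1)
    simp only [one_div, inv_pow] at this
    simp only [div_eq_mul_inv, ← Finset.mul_sum]
    exact mul_le_mul_of_nonneg_left this hG.totalCost_nonneg
  linarith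

theorem Nonneg.levelBudget_pos (hG : G.Nonneg) (hW : 0 < G.totalCost) (i : ℕ) :
    0 < G.levelBudget i := by
  have := Finset.sum_nonneg fun e (_ : e ∈ Finset.univ) => hG.levelCost_nonneg i e
  rw [levelBudget]
  positivity

theorem Nonneg.sum_cutIndicator_mul_levelCost_le (hG : G.Nonneg) (T : Finset (Fin n)) (i : ℕ) :
    ∑ e, cutIndicator T e * G.levelCost i e ≤ G.levelBudget i := by
  have W_nonneg := hG.totalCost_nonneg
  rw [levelBudget, add_assoc]
  exact le_add_of_le_of_nonneg (Finset.sum_le_sum fun e _ =>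
    mul_le_of_le_one_left (hG.levelCost_nonneg i e) (cutIndicator_le_one T e)) (by positivity)

theorem Nonneg.le_two_pow_mul_levelBudget (hG : G.Nonneg) (hn : 2 ≤ n) (i : ℕ) :
    (2 ^ i / (5 * Real.log n) + 1) * G.totalCost ≤ 2 ^ i * G.levelBudget i :=
  calc (2 ^ i / (5 * Real.log n) + 1) * G.totalCost
      ≤ (2 ^ i / (Nat.clog 2 n + 1) + 1) * G.totalCost := by
        have := hG.totalCost_nonneg
        gcongr
        exact clog_two_add_one_le hn
    _ = 2 ^ i * (G.totalCost / (Nat.clog 2 n + 1) + G.totalCost / 2 ^ i) := by field_simp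
    _ ≤ 2 ^ i * G.levelBudget i := by
        rw [levelBudget, add_assoc]
        exact mul_le_mul_of_nonneg_left (le_add_of_nonneg_left
          (Finset.sum_nonneg fun e _ => hG.levelCost_nonneg i e)) (by positivity)

section Sampling

variable {p : PMF (Sym2 (Fin n))} {q : ℕ} {γ : ℝ}

theorem Nonneg.levelCost_le (hG : G.Nonneg)
    (hp : ∀ u v, G.cost s(u, v) ≤ n * G.wdeg u * (p s(u, v)).toReal) (i : ℕ)
    (e : Sym2 (Fin n)) : G.levelCost i e ≤ n * (G.totalCost / 2 ^ i) * (p e).toReal := by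
  have W_nonneg := hG.totalCost_nonneg
  rw [levelCost]
  split_ifs with he
  · subst he
    induction e using Sym2.ind with
    | _ u v =>
      rw [edgeLevel_mk]
      rcases max_choice (G.vertexLevel u) (G.vertexLevel v) with h | h <;> rw [h]
      · refine (hp u v).trans ?_
        gcongr
        exact hG.wdeg_le_of_vertexLevel u
      · rw [Sym2.eq_swap]
        refine (hp v u).trans ?_
        gcongr
        exact hG.wdeg_le_of_vertexLevel v
  · positivity

/-- The difference between the sampled weight and the cost of the edges of level `i` in the
cut `S`. -/
noncomputable def levelError (G : WGraph n) (p : PMF (Sym2 (Fin n))) (i : ℕ)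
    (S : Finset (Fin n)) (ω : Fin q → Sym2 (Fin n)) : ℝ :=
  importanceSum p (fun e => cutIndicator S e * G.levelCost i e) ω -
    ∑ e, cutIndicator S e * G.levelCost i e

theorem levelError_filter (G : WGraph n) (p : PMF (Sym2 (Fin n))) (i : ℕ) (S : Finset (Fin n))
    (ω : Fin q → Sym2 (Fin n)) :
    G.levelError p i (S.filter fun v => G.vertexLevel v ≤ i) ω = G.levelError p i S ω := by
  simp only [levelError, cutIndicator_filter_mul_levelCost]

theorem sum_levelError (G : WGraph n) (p : PMF (Sym2 (Fin n))) (S : Finset (Fin n))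
    (ω : Fin q → Sym2 (Fin n)) :
    ∑ i ∈ Finset.range (Nat.clog 2 n + 1), G.levelError p i S ω =
      (G.sampledGraph p ω).cut S - G.cut S := by
  simp only [levelError, Finset.sum_sub_distrib, cut_sampledGraph, cut_eq_sum_cutIndicator G,
    importanceSum]
  rw [Finset.sum_comm, Finset.sum_comm (s := Finset.range _)]
  simp only [← Finset.sum_div, ← Finset.mul_sum, sum_levelCost]

theorem Nonneg.iidDist_levelError_le (hG : G.Nonneg) (hW : 0 < G.totalCost) (hn : 2 ≤ n)
    (hp : ∀ u v, G.cost s(u, v) ≤ n * G.wdeg u * (p s(u, v)).toReal) (hγ : 0 < γ) (hγ1 : γ ≤ 1)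
    (hq : 60 * (n * Real.log n) ≤ γ ^ 2 * q) (i : ℕ) (T : Finset (Fin n)) :
    (iidDist p q).toOuterMeasure {ω | γ * G.levelBudget i ≤ |G.levelError p i T ω|} ≤
      ENNReal.ofReal (2 * Real.exp (-(3 * 2 ^ i + 2 * Real.log n))) := by
  have log_pos : 0 < Real.log n := Real.log_pos (by exact_mod_cast hn)
  have q_pos : (0 : ℝ) < q := by
    have : 0 < γ ^ 2 * q := lt_of_lt_of_le (by positivity) hq
    exact pos_of_mul_pos_right this (by positivity)
  have M_pos := hG.levelBudget_pos hW i
  refine (iidDist_abs_importanceSum_sub_ge_le (b := n * G.totalCost / (2 ^ i * q))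
    (M := G.levelBudget i) (fun e => mul_nonneg (cutIndicator_nonneg T e) (hG.levelCost_nonneg i e))
    (fun e => ?_) (by positivity) (hG.sum_cutIndicator_mul_levelCost_le T i) (mul_pos hγ M_pos)
    (mul_le_of_le_one_left M_pos.le hγ1)).trans ?_
  · refine ((mul_le_of_le_one_left (hG.levelCost_nonneg i e) (cutIndicator_le_one T e)).trans
      (hG.levelCost_le hp i e)).trans_eq ?_
    field_simp
  · gcongr
    have factor : 15 * Real.log n ≤ γ ^ 2 * q / (4 * n) := by
      rw [le_div_iff₀ (by positivity)]
      linarith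
    calc 3 * 2 ^ i + 2 * Real.log n
        ≤ 15 * Real.log n * (2 ^ i / (5 * Real.log n) + 1) := by
          have : 15 * Real.log n * (2 ^ i / (5 * Real.log n)) = 3 * 2 ^ i := by
            field_simp
            ring
          linarith
      _ ≤ γ ^ 2 * q / (4 * n) * (2 ^ i * G.levelBudget i / G.totalCost) := by
          gcongr
          exact (le_div_iff₀ hW).2 (hG.le_two_pow_mul_levelBudget hn i)
      _ = (γ * G.levelBudget i) ^ 2 /
            (4 * (n * G.totalCost / (2 ^ i * q)) * G.levelBudget i) := by field_simp

theorem two_pow_two_pow_le_exp (i : ℕ) : (2 : ℝ) ^ 2 ^ (i + 2) ≤ Real.exp (3 * 2 ^ i) := by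
  rw [← Real.log_le_iff_le_exp (by positivity), Real.log_pow]
  push_cast
  calc (2 : ℝ) ^ (i + 2) * Real.log 2 = 4 * Real.log 2 * 2 ^ i := by ring
    _ ≤ 3 * 2 ^ i := by
        gcongr
        linarith [Real.log_two_lt_d9]

theorem Nonneg.iidDist_exists_levelError_le (hG : G.Nonneg) (hW : 0 < G.totalCost) (hn : 2 ≤ n)
    (hp : ∀ u v, G.cost s(u, v) ≤ n * G.wdeg u * (p s(u, v)).toReal) (hγ : 0 < γ) (hγ1 : γ ≤ 1)
    (hq : 60 * (n * Real.log n) ≤ γ ^ 2 * q) (i : ℕ) :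
    (iidDist p q).toOuterMeasure {ω | ∃ S, γ * G.levelBudget i ≤ |G.levelError p i S ω|} ≤
      ENNReal.ofReal (2 / n ^ 2) := by
  set A := Finset.univ.filter fun v => G.vertexLevel v ≤ i
  set B := 2 * Real.exp (-(3 * 2 ^ i + 2 * Real.log n))
  have cover : {ω : Fin q → Sym2 (Fin n) | ∃ S, γ * G.levelBudget i ≤ |G.levelError p i S ω|} ⊆
      ⋃ T ∈ A.powerset, {ω | γ * G.levelBudget i ≤ |G.levelError p i T ω|} := by
    rintro ω ⟨S, hS⟩
    rw [← levelError_filter] at hS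
    exact Set.mem_biUnion (Finset.mem_coe.2 (Finset.mem_powerset.2
      (Finset.filter_subset_filter _ S.subset_univ))) hS
  have card_le : ((2 ^ A.card : ℕ) : ℝ) ≤ Real.exp (3 * 2 ^ i) := by
    refine le_trans ?_ (two_pow_two_pow_le_exp i)
    exact_mod_cast Nat.pow_le_pow_right two_pos (hG.card_vertexLevel_le i)
  have exp_log : Real.exp (-(2 * Real.log n)) = 1 / (n : ℝ) ^ 2 := by
    rw [Real.exp_neg, ← Nat.cast_two, ← Real.log_pow, Real.exp_log (by positivity), one_div]
  calc (iidDist p q).toOuterMeasure {ω | ∃ S, γ * G.levelBudget i ≤ |G.levelError p i S ω|}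
      ≤ ∑ T ∈ A.powerset,
          (iidDist p q).toOuterMeasure {ω | γ * G.levelBudget i ≤ |G.levelError p i T ω|} :=
        (MeasureTheory.measure_mono cover).trans (MeasureTheory.measure_biUnion_finset_le _ _)
    _ ≤ ∑ _T ∈ A.powerset, ENNReal.ofReal B :=
        Finset.sum_le_sum fun T _ => hG.iidDist_levelError_le hW hn hp hγ hγ1 hq i T
    _ = ENNReal.ofReal ((2 ^ A.card : ℕ) * B) := by
        rw [Finset.sum_const, Finset.card_powerset, nsmul_eq_mul,
          ENNReal.ofReal_mul (Nat.cast_nonneg _), ENNReal.ofReal_natCast]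
    _ ≤ ENNReal.ofReal (Real.exp (3 * 2 ^ i) * B) := by gcongr
    _ = ENNReal.ofReal (2 / n ^ 2) := by
        rw [mul_left_comm, neg_add, Real.exp_add, ← mul_assoc (Real.exp _), ← Real.exp_add,
          add_neg_cancel, Real.exp_zero, one_mul, exp_log, mul_one_div]

theorem Nonneg.abs_cut_sampledGraph_sub_le (hG : G.Nonneg) (hγ : 0 ≤ γ) {S : Finset (Fin n)}
    {ω : Fin q → Sym2 (Fin n)}
    (h : ∀ i ∈ Finset.range (Nat.clog 2 n + 1), |G.levelError p i S ω| ≤ γ * G.levelBudget i) :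
    |(G.sampledGraph p ω).cut S - G.cut S| ≤ 4 * γ * G.totalCost :=
  calc |(G.sampledGraph p ω).cut S - G.cut S|
      ≤ ∑ i ∈ Finset.range (Nat.clog 2 n + 1), |G.levelError p i S ω| :=
        G.sum_levelError p S ω ▸ Finset.abs_sum_le_sum_abs _ _
    _ ≤ ∑ i ∈ Finset.range (Nat.clog 2 n + 1), γ * G.levelBudget i := Finset.sum_le_sum h
    _ ≤ γ * (4 * G.totalCost) := by
        rw [← Finset.mul_sum]
        exact mul_le_mul_of_nonneg_left hG.sum_levelBudget_le hγ
    _ = 4 * γ * G.totalCost := by ring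

theorem Nonneg.iidDist_cut_error_le (hG : G.Nonneg) (hW : 0 < G.totalCost) (hn : 2 ≤ n)
    (hp : ∀ u v, G.cost s(u, v) ≤ n * G.wdeg u * (p s(u, v)).toReal) {β : ℝ} (hβ : 0 < β)
    (hβ4 : β ≤ 4) (hq : 960 * (n * Real.log n) ≤ β ^ 2 * q) :
    (iidDist p q).toOuterMeasure
        {ω | ∃ S, β * G.totalCost < |(G.sampledGraph p ω).cut S - G.cut S|} ≤
      ENNReal.ofReal (10 / n) := by
  set L := Nat.clog 2 n
  have cover : {ω : Fin q → Sym2 (Fin n) |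
      ∃ S, β * G.totalCost < |(G.sampledGraph p ω).cut S - G.cut S|} ⊆
      ⋃ i ∈ Finset.range (L + 1), {ω | ∃ S, β / 4 * G.levelBudget i ≤ |G.levelError p i S ω|} := by
    rintro ω ⟨S, hS⟩
    by_contra not_covered
    simp only [Set.mem_iUnion, Set.mem_ofPred_eq, not_exists, not_le] at not_covered
    have error_le := hG.abs_cut_sampledGraph_sub_le (γ := β / 4) (by positivity) fun i hi =>
      (not_covered i hi S).le
    exact hS.not_ge (error_le.trans_eq (by ring))
  calc (iidDist p q).toOuterMeasure
        {ω | ∃ S, β * G.totalCost < |(G.sampledGraph p ω).cut S - G.cut S|}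
      ≤ ∑ i ∈ Finset.range (L + 1), (iidDist p q).toOuterMeasure
          {ω | ∃ S, β / 4 * G.levelBudget i ≤ |G.levelError p i S ω|} :=
        (MeasureTheory.measure_mono cover).trans (MeasureTheory.measure_biUnion_finset_le _ _)
    _ ≤ ∑ _i ∈ Finset.range (L + 1), ENNReal.ofReal (2 / n ^ 2) :=
        Finset.sum_le_sum fun i _ => hG.iidDist_exists_levelError_le hW hn hp (by positivity)
          (by linarith) (by linarith) i
    _ = ENNReal.ofReal ((L + 1) * (2 / n ^ 2)) := by
        rw [Finset.sum_const, Finset.card_range, nsmul_eq_mul, ← ENNReal.ofReal_natCast,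
          ← ENNReal.ofReal_mul (Nat.cast_nonneg _), Nat.cast_succ]
    _ ≤ ENNReal.ofReal (10 / n) := by
        have n_pos : (0 : ℝ) < n := by positivity
        have log_le : Real.log n ≤ n := (Real.log_le_sub_one_of_pos n_pos).trans (by linarith)
        refine ENNReal.ofReal_le_ofReal ?_
        calc ((L : ℝ) + 1) * (2 / n ^ 2) ≤ 5 * n * (2 / (n : ℝ) ^ 2) := by
              gcongr
              linarith [clog_two_add_one_le hn]
          _ = 10 / (n : ℝ) := by field_simp; norm_num

end Sampling

end WGraph

section Digits

theorem sum_testBit (x k : ℕ) :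
    ∑ j ∈ Finset.Icc 1 k, (if x.testBit (j - 1) = true then 2 ^ (j - 1) else 0) = x % 2 ^ k := by
  induction k with
  | zero => rw [pow_zero, Nat.mod_one, Finset.Icc_eq_empty (by omega), Finset.sum_empty]
  | succ k ih =>
    rw [Finset.sum_Icc_succ_top (by omega), ih, pow_succ, Nat.mod_mul, Nat.add_sub_cancel,
      Nat.testBit_eq_decide_div_mod_eq]
    rcases Nat.mod_two_eq_zero_or_one (x / 2 ^ k) with h | h <;> simp [h]

variable {x y : ℝ}

theorem lt_two_pow_one_add_floor_logb (hy : 0 < y) : y < 2 ^ (1 + ⌊Real.logb 2 y⌋₊) := by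
  have logb_lt := Nat.lt_floor_add_one (Real.logb 2 y)
  rw [Real.logb_lt_iff_lt_rpow one_lt_two hy] at logb_lt
  rw [add_comm, ← Real.rpow_natCast]
  exact_mod_cast logb_lt

theorem pow_pred_lt_and_le_pow_iff (hx : 1 < x) (hy : 0 < y) {j : ℕ} (hj : j ≠ 0) :
    x ^ (j - 1) < y ∧ y ≤ x ^ j ↔ j = ⌈Real.logb x y⌉₊ := by
  rw [eq_comm (a := j), Nat.ceil_eq_iff hj, Real.lt_logb_iff_rpow_lt hx hy,
    Real.logb_le_iff_le_rpow hx hy, Real.rpow_natCast, Real.rpow_natCast]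

end Digits

namespace WGraph

variable {n : ℕ} {H H' : WGraph n} {δ η ε : ℝ}

/-- The costs of `H'` are those of `H`, rounded down with relative error `δ` and absolute
error `η`. -/
def IsRounding (δ η : ℝ) (H H' : WGraph n) : Prop :=
  ∀ e, 0 ≤ H'.cost e ∧ H'.cost e ≤ H.cost e ∧ (1 - δ) * H.cost e - η ≤ H'.cost e

theorem IsRounding.nonneg (h : IsRounding δ η H H') : H'.Nonneg := fun e => (h e).1

theorem IsRounding.mono {δ' η' : ℝ} (h : IsRounding δ η H H') (hH : H.Nonneg) (hδ : δ ≤ δ')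
    (hη : η ≤ η') : IsRounding δ' η' H H' := fun e =>
  ⟨(h e).1, (h e).2.1, le_trans (by gcongr; exact hH e) (h e).2.2⟩

theorem IsRounding.cut_le (h : IsRounding δ η H H') (S : Finset (Fin n)) : H'.cut S ≤ H.cut S :=
  Finset.sum_le_sum fun _ _ => Finset.sum_le_sum fun _ _ => (h _).2.1

theorem IsRounding.le_cut (h : IsRounding δ η H H') (hη : 0 ≤ η) (S : Finset (Fin n)) :
    (1 - δ) * H.cut S - η * n ^ 2 / 4 ≤ H'.cut S := by
  have rounded : ∑ u ∈ S, ∑ v ∈ Sᶜ, ((1 - δ) * H.cost s(u, v) - η) ≤ H'.cut S :=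
    Finset.sum_le_sum fun u _ => Finset.sum_le_sum fun v _ => (h s(u, v)).2.2
  simp only [Finset.sum_sub_distrib, ← Finset.mul_sum, Finset.sum_const, nsmul_eq_mul] at rounded
  have card_add : (S.card : ℝ) + Sᶜ.card = n := by
    exact_mod_cast (S.card_add_card_compl).trans (Fintype.card_fin n)
  have card_mul : (Sᶜ.card : ℝ) * (S.card * η) ≤ η * n ^ 2 / 4 := by
    rw [← card_add]
    nlinarith [mul_nonneg hη (sq_nonneg ((S.card : ℝ) - Sᶜ.card))]
  exact (sub_le_sub_left card_mul _).trans rounded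

theorem cost_le_maxCost (H : WGraph n) {e : Sym2 (Fin n)} (he : e ∈ H.graph.edgeSet) :
    H.cost e ≤ H.maxCost :=
  le_csSup (Set.toFinite _).bddAbove (Set.mem_image_of_mem _ he)

theorem Nonneg.maxCost_nonneg (hH : H.Nonneg) : 0 ≤ H.maxCost :=
  Real.sSup_nonneg (by rintro _ ⟨e, -, rfl⟩; exact hH e)

theorem Nonneg.maxCost_le (hH : H.Nonneg) {B : ℝ} (hB : ∀ S, H.cut S ≤ B) : H.maxCost ≤ B := by
  refine Real.sSup_le ?_ ((hH.cut_nonneg ∅).trans (hB ∅))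
  rintro _ ⟨e, -, rfl⟩
  induction e using Sym2.ind with
  | _ u v => exact (hH.cost_le_wdeg u v).trans ((H.wdeg_eq_cut u).trans_le (hB {u}))

theorem natCast_pos_of_sym2 (e : Sym2 (Fin n)) : (0 : ℝ) < n := by
  induction e using Sym2.ind with
  | _ u _ => exact_mod_cast u.pos

open Classical in
theorem weightedSum_cost (k : ℕ) (α : ℕ → ℝ) (F : ℕ → SimpleGraph (Fin n)) (e : Sym2 (Fin n)) :
    (weightedSum k α F).cost e = ∑ j ∈ Finset.Icc 1 k, if e ∈ (F j).edgeSet then α j else 0 := rfl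

theorem mem_edgeSet_fromEdgeSet_sep (H : WGraph n) (P : Sym2 (Fin n) → Prop) (e : Sym2 (Fin n)) :
    e ∈ (SimpleGraph.fromEdgeSet {e ∈ H.graph.edgeSet | P e}).edgeSet ↔
      e ∈ H.graph.edgeSet ∧ P e := by
  rw [SimpleGraph.edgeSet_fromEdgeSet]
  exact ⟨fun h => h.1, fun h => ⟨h, H.graph.not_isDiag_of_mem_edgeSet h.1⟩⟩

theorem Nonneg.floor_cost_div_lt (hH : H.Nonneg) (hε : 0 < ε) (e : Sym2 (Fin n)) :
    ⌊H.cost e / (ε * H.maxCost / n ^ 2)⌋₊ <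
      2 ^ (1 + ⌊Real.logb 2 ((n : ℝ) ^ 2 / ε)⌋₊) := by
  have n_pos := natCast_pos_of_sym2 e
  have quotient_le : H.cost e / (ε * H.maxCost / n ^ 2) ≤ n ^ 2 / ε := by
    by_cases he : e ∈ H.graph.edgeSet
    · rcases hH.maxCost_nonneg.eq_or_lt with h | h
      · rw [← h, mul_zero, zero_div, div_zero]
        positivity
      · calc H.cost e / (ε * H.maxCost / n ^ 2) ≤ H.maxCost / (ε * H.maxCost / n ^ 2) := by
              gcongr
              exact H.cost_le_maxCost he
          _ = n ^ 2 / ε := by field_simp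
    · rw [H.cost_of_notMem e he, zero_div]
      positivity
  rw [← Nat.cast_lt (α := ℝ), Nat.cast_pow, Nat.cast_two]
  have η_nonneg : 0 ≤ ε * H.maxCost / n ^ 2 := by
    have := hH.maxCost_nonneg
    positivity
  exact ((Nat.floor_le (div_nonneg (hH e) η_nonneg)).trans quotient_le).trans_lt
    (lt_two_pow_one_add_floor_logb (by positivity))

theorem Nonneg.binaryDecompose_cost (hH : H.Nonneg) (hε : 0 < ε) (e : Sym2 (Fin n)) :
    (H.binaryDecompose ε).cost e =
      ε * H.maxCost / n ^ 2 * ⌊H.cost e / (ε * H.maxCost / n ^ 2)⌋₊ := by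
  have digits := sum_testBit ⌊H.cost e / (ε * H.maxCost / n ^ 2)⌋₊
    (1 + ⌊Real.logb 2 ((n : ℝ) ^ 2 / ε)⌋₊)
  rw [Nat.mod_eq_of_lt (hH.floor_cost_div_lt hε e)] at digits
  rw [← digits]
  push_cast
  rw [Finset.mul_sum, binaryDecompose, weightedSum_cost]
  refine Finset.sum_congr rfl fun j _ => ?_
  rw [mul_ite, mul_zero]
  have edge_of_digit (digit : ⌊H.cost e / (ε * H.maxCost / n ^ 2)⌋₊.testBit (j - 1) = true) :
      e ∈ H.graph.edgeSet := by
    by_contra he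
    rw [H.cost_of_notMem e he, zero_div, Nat.floor_zero, Nat.zero_testBit] at digit
    exact Bool.false_ne_true digit
  simp only [mem_edgeSet_fromEdgeSet_sep, and_iff_right_of_imp edge_of_digit]

theorem Nonneg.isRounding_binaryDecompose (hH : H.Nonneg) (hε : 0 < ε) :
    IsRounding 0 (ε * H.maxCost / n ^ 2) H (H.binaryDecompose ε) := fun e => by
  rw [hH.binaryDecompose_cost hε]
  have n_pos := natCast_pos_of_sym2 e
  have cost_nonneg := hH e
  rcases hH.maxCost_nonneg.eq_or_lt with h | h
  · have cost_le : H.cost e ≤ 0 := by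
      by_cases he : e ∈ H.graph.edgeSet
      · exact h ▸ H.cost_le_maxCost he
      · exact (H.cost_of_notMem e he).le
    simp only [← h, mul_zero, zero_div, zero_mul, sub_zero, one_mul]
    exact ⟨le_rfl, cost_nonneg, cost_le⟩
  · set η := ε * H.maxCost / n ^ 2
    have η_pos : 0 < η := by positivity
    have floor_le := Nat.floor_le (div_nonneg cost_nonneg η_pos.le)
    have lt_floor := Nat.lt_floor_add_one (H.cost e / η)
    rw [le_div_iff₀ η_pos] at floor_le
    rw [div_lt_iff₀ η_pos] at lt_floor
    exact ⟨by positivity, by linarith, by linarith⟩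

theorem Nonneg.expDecompose_cost_of_le (hH : H.Nonneg) (hε : 0 < ε) {e : Sym2 (Fin n)}
    (he : H.cost e ≤ ε * H.maxCost / (2 * n ^ 2)) : (H.expDecompose ε).cost e = 0 := by
  have τ_nonneg : 0 ≤ ε * H.maxCost / (2 * (n : ℝ) ^ 2) := by
    have := hH.maxCost_nonneg
    positivity
  rw [expDecompose, weightedSum_cost]
  refine Finset.sum_eq_zero fun j _ => if_neg fun hj => he.not_gt ?_
  rw [mem_edgeSet_fromEdgeSet_sep] at hj
  exact (le_mul_of_one_le_right τ_nonneg (one_le_pow₀ (by linarith))).trans_lt hj.2.1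

theorem Nonneg.expDecompose_cost_of_lt (hH : H.Nonneg) (hε : 0 < ε) {e : Sym2 (Fin n)}
    (he : ε * H.maxCost / (2 * n ^ 2) < H.cost e) :
    ∃ i : ℕ, ε * H.maxCost / (2 * n ^ 2) * (1 + ε / 2) ^ i < H.cost e ∧
      H.cost e ≤ ε * H.maxCost / (2 * n ^ 2) * (1 + ε / 2) ^ (i + 1) ∧
      (H.expDecompose ε).cost e = ε * H.maxCost / (2 * n ^ 2) * (1 + ε / 2) ^ i := by
  have n_pos := natCast_pos_of_sym2 e
  have max_nonneg := hH.maxCost_nonneg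
  have cost_pos : 0 < H.cost e := lt_of_le_of_lt (by positivity) he
  have e_mem : e ∈ H.graph.edgeSet := by
    by_contra h
    exact cost_pos.ne' (H.cost_of_notMem e h)
  have cost_le := H.cost_le_maxCost e_mem
  have max_pos := cost_pos.trans_le cost_le
  have base_gt : 1 < 1 + ε / 2 := by linarith
  set τ := ε * H.maxCost / (2 * (n : ℝ) ^ 2)
  have τ_pos : 0 < τ := by positivity
  set j := ⌈Real.logb (1 + ε / 2) (H.cost e / τ)⌉₊
  have scale : ∀ {i : ℕ}, i ≠ 0 →
      (τ * (1 + ε / 2) ^ (i - 1) < H.cost e ∧ H.cost e ≤ τ * (1 + ε / 2) ^ i ↔ i = j) :=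
    fun hi => by
      rw [← pow_pred_lt_and_le_pow_iff base_gt (by positivity) hi, lt_div_iff₀' τ_pos,
        div_le_iff₀' τ_pos]
  have j_pos : 0 < j := Nat.ceil_pos.2 (Real.logb_pos base_gt ((one_lt_div τ_pos).2 he))
  have j_le : j ≤ ⌈Real.logb (1 + ε / 2) (H.maxCost / τ)⌉₊ := by
    refine Nat.ceil_mono (Real.logb_le_logb_of_le base_gt (by positivity) ?_)
    gcongr
  obtain ⟨lower, upper⟩ := (scale j_pos.ne').2 rfl
  refine ⟨j - 1, lower, by rwa [Nat.sub_add_cancel j_pos], ?_⟩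
  rw [expDecompose, weightedSum_cost]
  refine (Finset.sum_eq_single j (fun i hi hij => if_neg fun h => hij ?_)
    fun h => absurd (Finset.mem_Icc.2 ⟨j_pos, j_le⟩) h).trans (if_pos ?_)
  · rw [mem_edgeSet_fromEdgeSet_sep] at h
    exact (scale (Nat.one_le_iff_ne_zero.1 (Finset.mem_Icc.1 hi).1)).1 h.2
  · exact (mem_edgeSet_fromEdgeSet_sep H _ e).2 ⟨e_mem, lower, upper⟩

theorem Nonneg.isRounding_expDecompose (hH : H.Nonneg) (hε : 0 < ε) :
    IsRounding (ε / 2) (ε * H.maxCost / (2 * n ^ 2)) H (H.expDecompose ε) := fun e => by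
  have cost_nonneg := hH e
  have max_nonneg := hH.maxCost_nonneg
  rcases le_or_gt (H.cost e) (ε * H.maxCost / (2 * n ^ 2)) with he | he
  · rw [hH.expDecompose_cost_of_le hε he]
    exact ⟨le_rfl, cost_nonneg, by linarith [mul_nonneg hε.le cost_nonneg]⟩
  · obtain ⟨i, lower, upper, cost_eq⟩ := hH.expDecompose_cost_of_lt hε he
    rw [cost_eq]
    set τ := ε * H.maxCost / (2 * (n : ℝ) ^ 2)
    have τ_nonneg : 0 ≤ τ := by positivity
    rw [pow_succ] at upper
    exact ⟨by positivity, lower.le, by linarith [mul_le_mul_of_nonneg_left lower.le hε.le]⟩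

theorem Nonneg.isRounding_bestDecompose (hH : H.Nonneg) (hε : 0 < ε) :
    IsRounding (ε / 2) (ε * H.maxCost / n ^ 2) H (H.bestDecompose ε) := by
  have max_nonneg := hH.maxCost_nonneg
  rw [bestDecompose]
  split_ifs
  · exact (hH.isRounding_binaryDecompose hε).mono hH (by positivity) le_rfl
  · refine (hH.isRounding_expDecompose hε).mono hH le_rfl ?_
    rw [mul_comm 2 ((n : ℝ) ^ 2), ← div_div]
    exact half_le_self (by positivity)

theorem Nonneg.le_cut_bestDecompose (hH : H.Nonneg) (hε : 0 < ε) {B : ℝ}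
    (hB : ∀ T, H.cut T ≤ B) (S : Finset (Fin n)) :
    H.cut S - ε * B ≤ (H.bestDecompose ε).cut S := by
  have max_mul_nonneg := mul_nonneg hε.le hH.maxCost_nonneg
  have rounded := (hH.isRounding_bestDecompose hε).le_cut (by positivity) S
  have cancel : ε * H.maxCost / (n : ℝ) ^ 2 * (n : ℝ) ^ 2 ≤ ε * H.maxCost := by
    rw [div_mul_eq_mul_div, mul_div_assoc]
    exact mul_le_of_le_one_right max_mul_nonneg (div_self_le_one _)
  linarith [mul_le_mul_of_nonneg_left (hB S) hε.le,
    mul_le_mul_of_nonneg_left (hH.maxCost_le hB) hε.le, mul_nonneg hε.le (hH.cut_nonneg S)]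

theorem pulseNumber_bestDecompose_le (H : WGraph n) (ε : ℝ) :
    (H.bestDecompose ε).pulseNumber ≤ (H.binaryDecompose ε).pulseNumber := by
  rw [bestDecompose]
  split_ifs with h
  exacts [le_rfl, not_lt.1 h]

end WGraph

namespace WGraph

variable {n q : ℕ} {G H : WGraph n} {β γ ε C₀ : ℝ}

/-- `H` is a sparse approximation of `G`: at most `q` pairs have nonzero cost in `H`, and every cut
has nearly the same value in both graphs. The error is relative to the total cost of `G`, not to the
cut, because only cuts of at least half the total cost have to be preserved. -/
structure IsCutSparsifier (G : WGraph n) (β : ℝ) (q : ℕ) (H : WGraph n) : Prop where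
  nonneg : H.Nonneg
  abs_cut_sub_le : ∀ S, |H.cut S - G.cut S| ≤ β * G.totalCost
  ncard_support_le : (Function.support H.cost).ncard ≤ q

theorem Nonneg.sampledGraph_nonneg (hG : G.Nonneg) (p : PMF (Sym2 (Fin n)))
    (ω : Fin q → Sym2 (Fin n)) : (G.sampledGraph p ω).Nonneg := fun e => by
  simp only [sampledGraph]
  refine Finset.sum_nonneg fun t _ => ?_
  split_ifs
  exacts [div_nonneg (hG e) (by positivity), le_rfl]

theorem support_sampledGraph_cost_subset (G : WGraph n) (p : PMF (Sym2 (Fin n)))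
    (ω : Fin q → Sym2 (Fin n)) : Function.support (G.sampledGraph p ω).cost ⊆ Set.range ω := by
  intro e he
  simp only [Function.mem_support, sampledGraph] at he
  by_contra not_sampled
  exact he (Finset.sum_eq_zero fun t _ => if_neg fun h => not_sampled ⟨t, h⟩)

theorem ncard_support_sampledGraph_cost_le (G : WGraph n) (p : PMF (Sym2 (Fin n)))
    (ω : Fin q → Sym2 (Fin n)) : (Function.support (G.sampledGraph p ω).cost).ncard ≤ q := by
  calc (Function.support (G.sampledGraph p ω).cost).ncard
      ≤ (Set.range ω).ncard := Set.ncard_le_ncard (G.support_sampledGraph_cost_subset p ω)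
    _ ≤ (Set.univ : Set (Fin q)).ncard := Set.image_univ ▸ Set.ncard_image_le
    _ = q := by rw [Set.ncard_univ, Nat.card_fin]

theorem Nonneg.le_iidDist_isCutSparsifier (hG : G.Nonneg) (hW : 0 < G.totalCost) (hn : 2 ≤ n)
    {p : PMF (Sym2 (Fin n))}
    (hp : ∀ u v, G.cost s(u, v) ≤ n * G.wdeg u * (p s(u, v)).toReal) (hβ : 0 < β) (hβ4 : β ≤ 4)
    (hq : 960 * (n * Real.log n) ≤ β ^ 2 * q) :
    ENNReal.ofReal (1 - 10 / n) ≤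
      (iidDist p q).toOuterMeasure {ω | G.IsCutSparsifier β q (G.sampledGraph p ω)} := by
  set good := {ω | G.IsCutSparsifier β q (G.sampledGraph p ω)}
  set bad := {ω : Fin q → _ | ∃ S, β * G.totalCost < |(G.sampledGraph p ω).cut S - G.cut S|}
  have cover : Set.univ ⊆ good ∪ bad := fun ω _ => or_iff_not_imp_right.2 fun hω =>
    ⟨hG.sampledGraph_nonneg p ω, fun S => not_lt.1 fun h => hω ⟨S, h⟩,
      G.ncard_support_sampledGraph_cost_le p ω⟩
  rw [ENNReal.ofReal_sub _ (by positivity), ENNReal.ofReal_one, tsub_le_iff_right]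
  calc (1 : ENNReal) = (iidDist p q).toOuterMeasure Set.univ :=
        (((iidDist p q).toOuterMeasure_apply_eq_one_iff _).2 (Set.subset_univ _)).symm
    _ ≤ (iidDist p q).toOuterMeasure good + (iidDist p q).toOuterMeasure bad :=
        (MeasureTheory.measure_mono cover).trans (MeasureTheory.measure_union_le _ _)
    _ ≤ (iidDist p q).toOuterMeasure good + ENNReal.ofReal (10 / n) := by
        gcongr
        exact hG.iidDist_cut_error_le hW hn hp hβ hβ4 hq

theorem Nonneg.totalCost_pos_of_tsum_leverage_ne_zero (hG : G.Nonneg)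
    (h : ∑' e, G.leverage e ≠ 0) : 0 < G.totalCost := by
  refine hG.totalCost_nonneg.lt_of_ne' fun hW => h ?_
  have cost_eq_zero := (Finset.sum_eq_zero_iff_of_nonneg fun e _ => hG e).1 hW
  simp only [leverage, cost_eq_zero _ (Finset.mem_univ _), zero_mul, ENNReal.ofReal_zero, tsum_zero]

theorem isCutSparsifier_edgeless (hG : ∀ e, G.cost e = 0) :
    G.IsCutSparsifier β q (edgeless n) where
  nonneg _ := le_rfl
  abs_cut_sub_le S := by
    simp only [cut, totalCost, edgeless, hG, Finset.sum_const_zero, sub_zero, abs_zero, mul_zero,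
      le_refl]
  ncard_support_le := by
    rw [edgeless, Function.support_fun_zero, Set.ncard_empty]
    exact q.zero_le

theorem Nonneg.le_sparsify_isCutSparsifier (hG : G.Nonneg) (hn : 2 ≤ n) (hε : ε ≠ 0) (hβ : 0 < β)
    (hβ4 : β ≤ 4) (hC₀ : 960 * ε ^ 2 ≤ β ^ 2 * C₀) :
    ENNReal.ofReal (1 - 10 / n) ≤ (G.sparsify C₀ ε).toOuterMeasure
      {H | G.IsCutSparsifier β ⌈C₀ * n * Real.log n / ε ^ 2⌉₊ H} := by
  rw [sparsify]
  split_ifs with h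
  · have enough_samples :
        960 * (n * Real.log n) ≤ β ^ 2 * ⌈C₀ * n * Real.log n / ε ^ 2⌉₊ := by
      have := Real.log_natCast_nonneg n
      calc 960 * (n * Real.log n) = 960 * ε ^ 2 * (n * Real.log n) / ε ^ 2 := by field_simp
        _ ≤ β ^ 2 * C₀ * (n * Real.log n) / ε ^ 2 := by gcongr
        _ = β ^ 2 * (C₀ * n * Real.log n / ε ^ 2) := by ring
        _ ≤ β ^ 2 * ⌈C₀ * n * Real.log n / ε ^ 2⌉₊ := by gcongr; exact Nat.le_ceil _
    rw [PMF.toOuterMeasure_map_apply]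
    exact hG.le_iidDist_isCutSparsifier (hG.totalCost_pos_of_tsum_leverage_ne_zero h) hn
      (hG.cost_le_edgeDist h) hβ hβ4 enough_samples
  · have edgeless_mem :
        edgeless n ∈ {H | G.IsCutSparsifier β ⌈C₀ * n * Real.log n / ε ^ 2⌉₊ H} :=
      isCutSparsifier_edgeless (hG.cost_eq_zero_of_tsum_leverage_eq_zero (not_not.1 h))
    rw [PMF.toOuterMeasure_pure_apply, if_pos edgeless_mem]
    exact ENNReal.ofReal_le_one.2 (sub_le_self _ (by positivity))

theorem IsCutSparsifier.cut_le (h : G.IsCutSparsifier β q H) (S : Finset (Fin n)) :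
    H.cut S ≤ G.cut S + β * G.totalCost := by
  linarith [(abs_le.1 (h.abs_cut_sub_le S)).2]

theorem IsCutSparsifier.cut_bestDecompose_le (h : G.IsCutSparsifier β q H) (hε : 0 < ε)
    (S : Finset (Fin n)) : (H.bestDecompose ε).cut S ≤ G.cut S + β * G.totalCost :=
  ((h.nonneg.isRounding_bestDecompose hε).cut_le S).trans (h.cut_le S)

theorem IsCutSparsifier.le_cut_bestDecompose (h : G.IsCutSparsifier β q H) (hG : G.Nonneg)
    (hε : 0 < ε) (S : Finset (Fin n)) :
    G.cut S - (β + ε * (1 + β)) * G.totalCost ≤ (H.bestDecompose ε).cut S := by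
  have cut_le (T : Finset (Fin n)) : H.cut T ≤ (1 + β) * G.totalCost := by
    linarith [h.cut_le T, hG.cut_le_totalCost T]
  linarith [h.nonneg.le_cut_bestDecompose hε cut_le S, (abs_le.1 (h.abs_cut_sub_le S)).1]

theorem mul_cut_le_of_forall_cut_sub_le {S : Finset (Fin n)} (hγ : 0 ≤ γ) (hγ2 : γ ≤ 1 / 2)
    (hS : ∀ T, G.cut T - γ * G.totalCost ≤ G.cut S) (T : Finset (Fin n)) :
    (1 - 2 * γ) * G.cut T ≤ G.cut S := by
  obtain ⟨large, totalCost_le, cut_le⟩ :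
      ∃ large, G.totalCost / 2 ≤ G.cut large ∧ G.cut T ≤ G.cut large := by
    obtain ⟨T', hT'⟩ := G.exists_totalCost_div_two_le_cut
    rcases le_total (G.cut T) (G.cut T') with h | h
    exacts [⟨T', hT', h⟩, ⟨T, hT'.trans h, le_rfl⟩]
  calc (1 - 2 * γ) * G.cut T ≤ (1 - 2 * γ) * G.cut large := by gcongr; linarith
    _ ≤ G.cut large - γ * G.totalCost := by linarith [mul_le_mul_of_nonneg_left totalCost_le hγ]
    _ ≤ G.cut S := hS large

end WGraph

namespace IonOp

variable {n : ℕ} {M M' : Fin n → Fin n → ℝ} {a a' l l' : ℕ}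

/-- The factor `±1` that the flips of `F` contribute to the couplings of the ion `u`. -/
def flipSign (F : Finset (Fin n)) (u : Fin n) : ℝ := if u ∈ F then -1 else 1

/-- The couplings `M` can be added by at most `l` operations, at most `a` of which are pulses. -/
def AddsWithin (M : Fin n → Fin n → ℝ) (a l : ℕ) : Prop :=
  ∃ ops, Adds ops M ∧ ops.countP isPulse ≤ a ∧ ops.length ≤ l

theorem addsWithin_zero : AddsWithin (0 : Fin n → Fin n → ℝ) 0 0 :=
  ⟨[], fun A => by rw [List.foldl_nil, add_zero], List.countP_nil.le, List.length_nil.le⟩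

theorem AddsWithin.mono (h : AddsWithin M a l) (ha : a ≤ a') (hl : l ≤ l') :
    AddsWithin M a' l' :=
  let ⟨ops, adds, pulses_le, length_le⟩ := h
  ⟨ops, adds, pulses_le.trans ha, length_le.trans hl⟩

theorem AddsWithin.add (h : AddsWithin M a l) (h' : AddsWithin M' a' l') :
    AddsWithin (M + M') (a + a') (l + l') := by
  obtain ⟨ops, adds, pulses_le, length_le⟩ := h
  obtain ⟨ops', adds', pulses_le', length_le'⟩ := h'
  refine ⟨ops ++ ops', fun A => ?_, ?_, ?_⟩
  · rw [List.foldl_append, adds, adds', add_assoc]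
  · rw [List.countP_append]
    exact add_le_add pulses_le pulses_le'
  · rw [List.length_append]
    exact add_le_add length_le length_le'

theorem AddsWithin.sum {ι : Type*} (s : Finset ι) {M : ι → Fin n → Fin n → ℝ}
    (h : ∀ i ∈ s, AddsWithin (M i) a l) :
    AddsWithin (∑ i ∈ s, M i) (s.card * a) (s.card * l) := by
  induction s using Finset.cons_induction with
  | empty => simpa only [Finset.sum_empty, Finset.card_empty, zero_mul] using addsWithin_zero
  | cons i s hi ih =>
    rw [Finset.sum_cons, Finset.card_cons, add_comm s.card, add_mul, add_mul, one_mul, one_mul]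
    exact (h i (Finset.mem_cons_self i s)).add (ih fun j hj => h j (Finset.mem_cons_of_mem hj))

theorem step_flip (s : IonState n) (v : Fin n) :
    step s (flip v) = ⟨symmDiff s.flipped {v}, s.coupling⟩ := by
  rw [step]
  congr 1
  ext u
  split_ifs with hv <;> simp only [Finset.mem_symmDiff, Finset.mem_singleton, Finset.mem_erase,
    Finset.mem_insert] <;> grind

theorem foldl_step_map_flip {vs : List (Fin n)} (hvs : vs.Nodup) (s : IonState n) :
    (vs.map flip).foldl step s = ⟨symmDiff s.flipped vs.toFinset, s.coupling⟩ := by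
  induction vs generalizing s with
  | nil => rw [List.map_nil, List.foldl_nil, List.toFinset_nil, ← Finset.bot_eq_empty,
      symmDiff_bot]
  | cons v vs ih =>
    obtain ⟨v_notMem, vs_nodup⟩ := List.nodup_cons.1 hvs
    have disjoint : Disjoint {v} vs.toFinset :=
      Finset.disjoint_singleton_left.2 (mt List.mem_toFinset.1 v_notMem)
    rw [List.map_cons, List.foldl_cons, step_flip, ih vs_nodup, symmDiff_assoc,
      disjoint.symmDiff_eq_sup, List.toFinset_cons]
    rfl

theorem step_pulse {c : ℝ} (hc : c ≠ 0) (s : IonState n) :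
    step s (pulse (decide (0 < c)) |c| (abs_pos.2 hc)) = ⟨s.flipped,
      s.coupling + fun u v => c * (flipSign s.flipped u * flipSign s.flipped v)⟩ := by
  have signed : (if decide (0 < c) = true then (1 : ℝ) else -1) * |c| = c := by
    rcases hc.lt_or_gt with h | h
    · simp [h.not_gt, abs_of_neg h]
    · simp [h, abs_of_pos h]
  rw [step]
  congr 1
  funext u v
  rw [mul_left_comm, signed, mul_comm, pow_add, Pi.add_apply, Pi.add_apply]
  simp only [flipSign, pow_ite, pow_one, pow_zero]

theorem addsWithin_flipSign (F : Finset (Fin n)) (c : ℝ) :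
    AddsWithin (fun u v => c * (flipSign F u * flipSign F v)) 1 (2 * F.card + 1) := by
  rcases eq_or_ne c 0 with rfl | hc
  · simp only [zero_mul]
    exact addsWithin_zero.mono zero_le_one (Nat.zero_le _)
  · have no_pulse : (F.toList.map flip).countP isPulse = 0 :=
      List.countP_eq_zero.2 (by simp [isPulse])
    refine ⟨F.toList.map flip ++ pulse (decide (0 < c)) |c| (abs_pos.2 hc) :: F.toList.map flip,
      fun A => ?_, ?_, ?_⟩
    · rw [List.foldl_append, List.foldl_cons, foldl_step_map_flip F.nodup_toList, step_pulse hc,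
        foldl_step_map_flip F.nodup_toList, Finset.toList_toFinset, ← Finset.bot_eq_empty,
        bot_symmDiff, symmDiff_self]
    · rw [List.countP_append, List.countP_cons_of_pos rfl, no_pulse]
    · rw [List.length_append, List.length_cons, List.length_map, Finset.length_toList]
      omega

theorem flipSign_insert {v : Fin n} {L : Finset (Fin n)} (hv : v ∉ L) (u : Fin n) :
    flipSign (insert v L) u = flipSign {v} u * flipSign L u := by
  rcases eq_or_ne u v with rfl | huv
  · simp [flipSign, hv]
  · simp [flipSign, huv]

theorem addsWithin_star {v : Fin n} {L : Finset (Fin n)} (hv : v ∉ L) (c : ℝ) :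
    AddsWithin (fun u w => if u = v ∧ w ∈ L ∨ w = v ∧ u ∈ L then c else 0) 4 (8 + 4 * L.card) := by
  -- With `x = flipSign {v}` and `y = flipSign L`, the star is the matrix
  -- `c / 4 * ((1 - x u * x w) * (1 - y u * y w))`.
  have star_eq : (fun u w => if u = v ∧ w ∈ L ∨ w = v ∧ u ∈ L then c else 0) =
      (fun u w => c / 4 * (flipSign ∅ u * flipSign ∅ w)) +
        (fun u w => -(c / 4) * (flipSign {v} u * flipSign {v} w)) +
        (fun u w => -(c / 4) * (flipSign L u * flipSign L w)) +
        fun u w => c / 4 * (flipSign (insert v L) u * flipSign (insert v L) w) := by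
    funext u w
    simp only [Pi.add_apply, flipSign_insert hv]
    simp only [flipSign, Finset.notMem_empty, if_false, Finset.mem_singleton]
    split_ifs <;> simp_all <;> ring
  rw [star_eq]
  refine ((((addsWithin_flipSign ∅ (c / 4)).add (addsWithin_flipSign {v} _)).add
    (addsWithin_flipSign L _)).add (addsWithin_flipSign (insert v L) _)).mono le_rfl ?_
  rw [Finset.card_insert_of_notMem hv, Finset.card_empty, Finset.card_singleton]
  omega

theorem addsWithin_edge {u v : Fin n} (huv : u ≠ v) (c : ℝ) :
    AddsWithin (fun x y => if s(x, y) = s(u, v) then c else 0) 4 12 := by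
  have star := addsWithin_star (Finset.notMem_singleton.2 huv) c
  simpa only [Finset.mem_singleton, Finset.card_singleton, Sym2.eq_iff, and_comm (a := _ = v)]
    using star

open Classical in
theorem addsWithin_simpleGraph (F : SimpleGraph (Fin n)) (c : ℝ) :
    AddsWithin (fun u v => if F.Adj u v then c else 0) (n * 4) (n * (8 + 4 * n)) := by
  have stars := AddsWithin.sum Finset.univ fun (v : Fin n) _ =>
    (addsWithin_star (v := v) (L := {w | v < w ∧ F.Adj v w})
      (fun h => (Finset.mem_filter.1 h).2.1.false) c).mono le_rfl
      (Nat.add_le_add_left (Nat.mul_le_mul_left 4 (card_finset_fin_le _)) 8)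
  rw [Finset.card_univ, Fintype.card_fin] at stars
  convert stars using 1
  funext u w
  have center_iff (v : Fin n) : (u = v ∧ v < w ∧ F.Adj v w ∨ w = v ∧ v < u ∧ F.Adj v u) ↔
      min u w = v ∧ F.Adj u w := by
    rcases lt_trichotomy u w with h | rfl | h <;> grind [SimpleGraph.adj_comm, SimpleGraph.irrefl]
  simp only [Finset.sum_apply, Finset.mem_filter, Finset.mem_univ, true_and, center_iff, ite_and,
    Finset.sum_ite_eq, if_true]

theorem Adds.compiles {ops : List (IonOp n)} (h : Adds ops M) {G : WGraph n}
    (hM : ∀ u v, u ≠ v → M u v = G.cost s(u, v)) : Compiles ops G := by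
  have run_eq : run ops = ⟨∅, 0 + M⟩ := h 0
  rw [Compiles, run_eq, zero_add]
  exact ⟨rfl, hM⟩

end IonOp

namespace WGraph

open IonOp

variable {n : ℕ} {G : WGraph n} {M : Fin n → Fin n → ℝ} {a l : ℕ}

theorem pulseNumber_le_of_addsWithin (h : AddsWithin M a l)
    (hM : ∀ u v, u ≠ v → M u v = G.cost s(u, v)) : G.pulseNumber ≤ a := by
  obtain ⟨ops, adds, pulses_le, _⟩ := h
  have mem : ops ∈ {ops | Compiles ops G} := adds.compiles hM
  exact (Nat.sInf_le (Set.mem_image_of_mem _ mem)).trans pulses_le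

theorem totalOpsNumber_le_of_addsWithin (h : AddsWithin M a l)
    (hM : ∀ u v, u ≠ v → M u v = G.cost s(u, v)) : G.totalOpsNumber ≤ l := by
  obtain ⟨ops, adds, _, length_le⟩ := h
  have mem : ops ∈ {ops | Compiles ops G} := adds.compiles hM
  exact (Nat.sInf_le (Set.mem_image_of_mem _ mem)).trans length_le

theorem pulseNumber_weightedSum_le (k : ℕ) (α : ℕ → ℝ) (F : ℕ → SimpleGraph (Fin n)) :
    (weightedSum k α F).pulseNumber ≤ k * (n * 4) := by
  have layers := AddsWithin.sum (Finset.Icc 1 k) fun j _ => addsWithin_simpleGraph (F j) (α j)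
  rw [Nat.card_Icc, Nat.add_sub_cancel] at layers
  refine pulseNumber_le_of_addsWithin layers fun u v _ => ?_
  rw [weightedSum_cost, Finset.sum_apply, Finset.sum_apply]
  rfl

theorem totalOpsNumber_le_ncard_support (G : WGraph n) :
    G.totalOpsNumber ≤ (Function.support G.cost).ncard * 12 := by
  classical
  have edge (e) (he : e ∈ (Function.support G.cost).toFinset) :
      AddsWithin (fun u v => if s(u, v) = e then G.cost e else 0) 4 12 := by
    induction e using Sym2.ind with
    | _ u v =>
      refine addsWithin_edge (fun huv => ?_) _
      rw [huv, Set.mem_toFinset] at he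
      exact he (G.cost_diag v)
  have edges := AddsWithin.sum _ edge
  rw [← Set.ncard_eq_toFinset_card'] at edges
  refine totalOpsNumber_le_of_addsWithin edges fun u v _ => ?_
  simp only [Finset.sum_apply, Finset.sum_ite_eq, Set.mem_toFinset, Function.mem_support,
    ite_eq_left_iff, not_not]
  exact Eq.symm

end WGraph

section Estimates

variable {n : ℕ} {x ε C₀ : ℝ}

theorem half_le_log (hx : 2 ≤ x) : 1 / 2 ≤ Real.log x := by
  linarith [Real.log_two_gt_d9, Real.log_le_log two_pos hx]

theorem one_add_floor_logb_two_sq_le (hx : 2 ≤ x) :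
    ((1 + ⌊Real.logb 2 (x ^ 2)⌋₊ : ℕ) : ℝ) ≤ 5 * Real.log x := by
  have half_le := half_le_log hx
  have logb_eq : Real.logb 2 (x ^ 2) = 2 * Real.log x / Real.log 2 := by
    rw [Real.logb, Real.log_pow, Nat.cast_two]
  have logb_le : Real.logb 2 (x ^ 2) ≤ 3 * Real.log x := by
    rw [logb_eq, div_le_iff₀ (Real.log_pos one_lt_two)]
    nlinarith [Real.log_two_gt_d9]
  have logb_nonneg : 0 ≤ Real.logb 2 (x ^ 2) := by
    rw [logb_eq]
    positivity
  rw [Nat.cast_add, Nat.cast_one]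
  linarith [Nat.floor_le logb_nonneg]

theorem log_mul_three_le (hx : 2 ≤ x) : Real.log (x * 3) ≤ 3 * Real.log x := by
  calc Real.log (x * 3) ≤ Real.log (x ^ 3) := by
        refine Real.log_le_log (by linarith) ?_
        rw [pow_succ' x 2]
        gcongr
        nlinarith
    _ = 3 * Real.log x := by rw [Real.log_pow, Nat.cast_ofNat]

theorem two_le_natCast_div (hn : 2 ≤ n) (hε : 0 < ε) (hε1 : ε ≤ 1) : 2 ≤ n / ε := by
  rw [le_div_iff₀ hε]
  have : (2 : ℝ) ≤ n := by exact_mod_cast hn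
  linarith

theorem ceil_sampleSize_le (hn : 2 ≤ n) (hε : 0 < ε) (hε1 : ε ≤ 1) (hC₀ : 0 ≤ C₀) :
    (⌈C₀ * n * Real.log n / (ε / 3) ^ 2⌉₊ : ℝ) ≤
      (9 * C₀ + 1) * (n * Real.log (n / ε) / ε ^ 2) := by
  have two_le : (2 : ℝ) ≤ n := by exact_mod_cast hn
  have log_le : Real.log n ≤ Real.log (n / ε) :=
    Real.log_le_log (by positivity) (le_div_self (by positivity) hε hε1)
  have one_le : 1 ≤ n * Real.log (n / ε) / ε ^ 2 := by
    rw [le_div_iff₀ (by positivity)]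
    nlinarith [half_le_log two_le, pow_le_one₀ (n := 2) hε.le hε1]
  have real_le : C₀ * n * Real.log n / (ε / 3) ^ 2 ≤ 9 * C₀ * (n * Real.log (n / ε) / ε ^ 2) := by
    calc C₀ * n * Real.log n / (ε / 3) ^ 2 = 9 * C₀ * (n * Real.log n / ε ^ 2) := by
          field_simp
          norm_num
      _ ≤ 9 * C₀ * (n * Real.log (n / ε) / ε ^ 2) := by gcongr
  linarith [Nat.ceil_lt_add_one (show 0 ≤ C₀ * n * Real.log n / (ε / 3) ^ 2 by positivity)]

end Estimates

namespace WGraph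

variable {n q : ℕ} {G H : WGraph n} {β ε C₀ : ℝ}

theorem pulseNumber_binaryDecompose_le_mul (H : WGraph n) (ε : ℝ) :
    (H.binaryDecompose ε).pulseNumber ≤ (1 + ⌊Real.logb 2 ((n : ℝ) ^ 2 / ε)⌋₊) * (n * 4) :=
  pulseNumber_weightedSum_le _ _ _

theorem pulseNumber_binaryDecompose_le (H : WGraph n) (hn : 2 ≤ n) (hε : 0 < ε) (hε1 : ε ≤ 1) :
    ((H.binaryDecompose ε).pulseNumber : ℝ) ≤ 20 * (n * Real.log (n / ε)) := by
  have sq_div_le : (n : ℝ) ^ 2 / ε ≤ (n / ε) ^ 2 := by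
    rw [div_pow]
    gcongr
    exact pow_le_of_le_one hε.le hε1 two_ne_zero
  have digits_le : 1 + ⌊Real.logb 2 ((n : ℝ) ^ 2 / ε)⌋₊ ≤ 1 + ⌊Real.logb 2 ((n / ε) ^ 2)⌋₊ := by
    gcongr
    exact one_lt_two
  calc ((H.binaryDecompose ε).pulseNumber : ℝ)
      ≤ ((1 + ⌊Real.logb 2 ((n / ε) ^ 2)⌋₊ : ℕ) : ℝ) * (n * 4) := by
        exact_mod_cast (H.pulseNumber_binaryDecompose_le_mul ε).trans
          (Nat.mul_le_mul_right _ digits_le)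
    _ ≤ 5 * Real.log (n / ε) * (n * 4) := by
        gcongr
        exact one_add_floor_logb_two_sq_le (two_le_natCast_div hn hε hε1)
    _ = 20 * (n * Real.log (n / ε)) := by ring

theorem pulseNumber_bestDecompose_div_three_le (H : WGraph n) (hn : 2 ≤ n) (hε : 0 < ε)
    (hε1 : ε ≤ 1) :
    ((H.bestDecompose (ε / 3)).pulseNumber : ℝ) ≤ 60 * (n * Real.log (n / ε)) := by
  have log_le : Real.log (n / (ε / 3)) ≤ 3 * Real.log (n / ε) := by
    rw [div_div_eq_mul_div, mul_div_right_comm]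
    exact log_mul_three_le (two_le_natCast_div hn hε hε1)
  calc ((H.bestDecompose (ε / 3)).pulseNumber : ℝ)
      ≤ (H.binaryDecompose (ε / 3)).pulseNumber := by
        exact_mod_cast H.pulseNumber_bestDecompose_le (ε / 3)
    _ ≤ 20 * (n * Real.log (n / (ε / 3))) :=
        H.pulseNumber_binaryDecompose_le hn (by positivity) (by linarith)
    _ ≤ 20 * (n * (3 * Real.log (n / ε))) := by gcongr
    _ = 60 * (n * Real.log (n / ε)) := by ring

theorem IsCutSparsifier.totalOpsNumber_bestDecompose_le (h : G.IsCutSparsifier β q H)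
    (hε : 0 < ε) : (H.bestDecompose ε).totalOpsNumber ≤ q * 12 := by
  have support_subset :
      Function.support (H.bestDecompose ε).cost ⊆ Function.support H.cost := fun e he h0 =>
    have rounded := h.nonneg.isRounding_bestDecompose hε e
    he (le_antisymm (rounded.2.1.trans_eq h0) rounded.1)
  exact (totalOpsNumber_le_ncard_support _).trans
    (Nat.mul_le_mul_right _ ((Set.ncard_le_ncard support_subset).trans h.ncard_support_le))

theorem IsCutSparsifier.totalOpsNumber_bestDecompose_div_three_le
    (h : G.IsCutSparsifier β ⌈C₀ * n * Real.log n / (ε / 3) ^ 2⌉₊ H) (hn : 2 ≤ n) (hε : 0 < ε)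
    (hε1 : ε ≤ 1) (hC₀ : 0 ≤ C₀) :
    ((H.bestDecompose (ε / 3)).totalOpsNumber : ℝ) ≤
      (108 * C₀ + 12) * (n * Real.log (n / ε) / ε ^ 2) := by
  calc ((H.bestDecompose (ε / 3)).totalOpsNumber : ℝ)
      ≤ ⌈C₀ * n * Real.log n / (ε / 3) ^ 2⌉₊ * 12 := by
        exact_mod_cast h.totalOpsNumber_bestDecompose_le (by positivity)
    _ ≤ (9 * C₀ + 1) * (n * Real.log (n / ε) / ε ^ 2) * 12 := by
        gcongr
        exact ceil_sampleSize_le hn hε hε1 hC₀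
    _ = (108 * C₀ + 12) * (n * Real.log (n / ε) / ε ^ 2) := by ring

theorem IsCutSparsifier.cut_bestDecompose_mem (h : G.IsCutSparsifier (ε / 16) q H) (hG : G.Nonneg)
    (hε : 0 < ε) (hε1 : ε ≤ 1) {S : Finset (Fin n)} (hS : G.totalCost / 2 ≤ G.cut S) :
    (1 - ε) * G.cut S ≤ (H.bestDecompose (ε / 3)).cut S ∧
      (H.bestDecompose (ε / 3)).cut S ≤ (1 + ε) * G.cut S := by
  have half_totalCost_le := mul_le_mul_of_nonneg_left hS hε.le
  have error_nonneg := mul_nonneg hε.le hG.totalCost_nonneg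
  have sq_error_le := mul_le_mul_of_nonneg_right hε1 error_nonneg
  have lower := h.le_cut_bestDecompose hG (ε := ε / 3) (by positivity) S
  have upper := h.cut_bestDecompose_le (ε := ε / 3) (by positivity) S
  constructor <;> linarith

theorem IsCutSparsifier.mul_cut_le_of_isMaxCut_bestDecompose
    (h : G.IsCutSparsifier (ε / 16) q H) (hG : G.Nonneg) (hε : 0 < ε) (hε1 : ε ≤ 1)
    {S : Finset (Fin n)} (hS : (H.bestDecompose (ε / 3)).IsMaxCut S) (T : Finset (Fin n)) :
    (1 - ε) * G.cut T ≤ G.cut S := by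
  have error_nonneg := mul_nonneg hε.le hG.totalCost_nonneg
  have sq_error_le := mul_le_mul_of_nonneg_right hε1 error_nonneg
  have near_max (T : Finset (Fin n)) : G.cut T - ε / 2 * G.totalCost ≤ G.cut S := by
    linarith [h.le_cut_bestDecompose hG (ε := ε / 3) (by positivity) T, hS T,
      h.cut_bestDecompose_le (ε := ε / 3) (by positivity) S]
  simpa only [mul_div_cancel₀ ε two_ne_zero] using
    mul_cut_le_of_forall_cut_sub_le (by positivity) (by linarith) near_max T

end WGraph

theorem one_sub_div_natCast_add_one_le {n : ℕ} (hn : 2 ≤ n) :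
    1 - 20 / (n + 1 : ℝ) ≤ 1 - 10 / n := by
  have two_le : (2 : ℝ) ≤ n := by exact_mod_cast hn
  gcongr ?_ - ?_
  rw [div_le_div_iff₀ (by positivity) (by positivity)]
  linarith

theorem tendsto_one_sub_div_natCast_add_one (c : ℝ) :
    Filter.Tendsto (fun n : ℕ => 1 - c / (n + 1)) Filter.atTop (nhds 1) := by
  have vanishing := (tendsto_one_div_add_atTop_nhds_zero_nat (𝕜 := ℝ)).const_mul c
  simpa only [mul_one_div, mul_zero, sub_zero] using vanishing.const_sub 1

theorem mainTheorem3_general :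
    ∃ K : ℝ, 0 < K ∧ ∀ C₀ : ℝ, K ≤ C₀ →
      ∃ C : ℝ, 0 < C ∧ ∃ p : ℕ → ℝ, Filter.Tendsto p Filter.atTop (nhds 1) ∧
        ∀ (n : ℕ) (G : WGraph n) (ε : ℝ), G.Nonneg → 0 < ε → ε < 1 →
          ENNReal.ofReal (p n) ≤
            (G.sparseUnionOfStars C₀ (ε / 3) (ε / 3)).toOuterMeasure {G' : WGraph n |
              G'.Nonneg ∧
              (∀ S : Finset (Fin n), G.totalCost / 2 ≤ G.cut S →
                (1 - ε) * G.cut S ≤ G'.cut S ∧ G'.cut S ≤ (1 + ε) * G.cut S) ∧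
              (∀ S : Finset (Fin n), G'.IsMaxCut S → ∀ T : Finset (Fin n),
                (1 - ε) * G.cut T ≤ G.cut S) ∧
              (G'.pulseNumber : ℝ) ≤ C * (n * Real.log (n / ε)) ∧
              (G'.totalOpsNumber : ℝ) ≤ C * (n * Real.log (n / ε) / ε ^ 2)} := by
  refine ⟨30000, by norm_num, fun C₀ hC₀ => ⟨108 * C₀ + 72, by linarith, fun n => 1 - 20 / (n + 1),
    tendsto_one_sub_div_natCast_add_one 20, fun n G ε hG hε hε1 => ?_⟩⟩
  rcases lt_or_ge n 2 with hn | hn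
  · have succ_le : (n : ℝ) + 1 ≤ 20 := by exact_mod_cast (by omega : n + 1 ≤ 20)
    rw [ENNReal.ofReal_of_nonpos (sub_nonpos.2 ((one_le_div (by positivity)).2 succ_le))]
    exact zero_le
  have log_nonneg : 0 ≤ Real.log (n / ε) :=
    one_half_pos.le.trans (half_le_log (two_le_natCast_div hn hε hε1.le))
  rw [WGraph.sparseUnionOfStars, PMF.toOuterMeasure_map_apply]
  refine (ENNReal.ofReal_le_ofReal (one_sub_div_natCast_add_one_le hn)).trans
    ((hG.le_sparsify_isCutSparsifier (β := ε / 16) hn (by positivity) (by positivity) (by linarith)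
      (by nlinarith [sq_nonneg ε])).trans
      (MeasureTheory.measure_mono fun H h => ⟨?_, ?_, ?_, ?_, ?_⟩))
  · exact (h.nonneg.isRounding_bestDecompose (by positivity)).nonneg
  · exact fun S hS => h.cut_bestDecompose_mem hG hε hε1.le hS
  · exact fun S hS T => h.mul_cut_le_of_isMaxCut_bestDecompose hG hε hε1.le hS T
  · exact (H.pulseNumber_bestDecompose_div_three_le hn hε hε1.le).trans (by gcongr; linarith)
  · exact (h.totalOpsNumber_bestDecompose_div_three_le hn hε hε1.le (by linarith)).trans
      (by gcongr; linarith)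

theorem mainTheorem3 :
    ∃ K : ℝ, 0 < K ∧ ∀ C₀ : ℝ, K ≤ C₀ →
      ∃ C : ℝ, 0 < C ∧ ∃ p : ℕ → ℝ, Filter.Tendsto p Filter.atTop (nhds 1) ∧
        ∀ (n : ℕ) (G : WGraph n) (ε : ℝ), G.graph.Connected → G.Nonneg → 0 < ε → ε < 1 →
          ENNReal.ofReal (p n) ≤
            (G.sparseUnionOfStars C₀ (ε / 3) (ε / 3)).toOuterMeasure {G' : WGraph n |
              G'.Nonneg ∧
              (∀ S : Finset (Fin n), G.totalCost / 2 ≤ G.cut S →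
                (1 - ε) * G.cut S ≤ G'.cut S ∧ G'.cut S ≤ (1 + ε) * G.cut S) ∧
              (∀ S : Finset (Fin n), G'.IsMaxCut S → ∀ T : Finset (Fin n),
                (1 - ε) * G.cut T ≤ G.cut S) ∧
              (G'.pulseNumber : ℝ) ≤ C * (n * Real.log (n / ε)) ∧
              (G'.totalOpsNumber : ℝ) ≤ C * (n * Real.log (n / ε) / ε ^ 2)} := by
  obtain ⟨K, hK, bounds⟩ := mainTheorem3_general
  exact ⟨K, hK, fun C₀ hC₀ => (bounds C₀ hC₀).imp fun _ ⟨hC, p, hp, le_prob⟩ =>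
    ⟨hC, p, hp, fun n G ε _ => le_prob n G ε⟩⟩
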